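/- For $\alpha>0$ and a set $\Gamma\subset\mathbb{R}$ put $p_\alpha(x)=\sum_{\gamma\in\Gamma}e^{-\pi\alpha(x-\gamma)^2}$, $x\in\mathbb{R}$. Let $\mathbb{T}=\mathbb{R}/\mathbb{Z}$, and for $x\in\mathbb{T}$ put $\theta_\alpha(x)=\sum_{k\in\mathbb{Z}}e^{-\pi\alpha k^2}e^{2\pi i k x}$ (which is real). A periodic configuration of density $\delta>0$ with $n\ge 1$ points per period is a set of the form $$\Gamma=\frac{n}{\delta}\Bigl(\bigcup_{k=1}^{n}(\mathbb{Z}+x_k)\Bigr),\qquad x_1,\dots,x_n\in[0,1)\ \text{pairwise distinct};$$ it is called equispaced if $\Gamma=z+\frac1\delta\mathbb{Z}$ for some $z\in\mathbb{R}$. A set of $n$ points on $\mathbb{T}$ is called equispaced if it equals $\{z+\frac jn : 0\le j\le n-1\}$ for some $z\in\mathbb{T}$. Let $\alpha>0$ and $n\ge1$. (1) Let $\delta>0$. For every periodic configuration $\Gamma$ of density $\delta$ with $n$ points per period, the series $p_\alpha(x)$ converges for every $x\in\mathbb{R}$ and $\max_{x\in\mathbb{R}}p_\alpha(x)$ exists.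 Such a $\Gamma$ minimizes $\max_{x\in\mathbb{R}}p_\alpha(x)$ among all periodic configurations of density $\delta$ with $n$ points per period if and only if it is equispaced. Likewise, it minimizes $\max_{x\in\mathbb{R}}p_\alpha(x)$ among all periodic configurations of density $\delta$ (with any number $m\ge1$ of points per period) if and only if it is equispaced. (2) For every set $\{x_1,\dots,x_n\}$ of $n$ distinct points on $\mathbb{T}$, the function $f_\alpha(x)=\sum_{j=1}^{n}\theta_\alpha(x-x_j)$ attains its maximum on $\mathbb{T}$. Such a set minimizes $\max_{x\in\mathbb{T}}f_\alpha(x)$ among all sets of $n$ distinct points on $\mathbb{T}$ if and only if it is equispaced. -/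

import Mathlib

open scoped Pointwise

noncomputable section

/-- The periodic configurations on the real line with `n` points per period and density `δ`: the
sets `(n / δ) • ⋃ k, (ℤ + x k)` with `x 1, …, x n ∈ [0, 1)` pairwise distinct and `n ≥ 1`. -/
def periodicConfigurations (n : ℕ) (δ : ℝ) : Set (Set ℝ) :=
  {Γ | 0 < n ∧ ∃ x : Fin n → ℝ, (∀ k, x k ∈ Set.Ico (0 : ℝ) 1) ∧ Function.Injective x ∧
    Γ = ((n : ℝ) / δ) • ⋃ k : Fin n, Set.range fun m : ℤ => (m : ℝ) + x k}

/-- `Γ` is an equispaced set of points of density `δ` on the real line, that is, a translate of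
`(1 / δ) ℤ`. -/
def IsEquispacedLine (δ : ℝ) (Γ : Set ℝ) : Prop :=
  ∃ z : ℝ, Γ = Set.range fun m : ℤ => z + (m : ℝ) / δ

/-- `p_α(x) = ∑_{γ ∈ Γ} exp (-π α (x - γ)²)`. -/
def gaussianSum (α : ℝ) (Γ : Set ℝ) (x : ℝ) : ℝ :=
  ∑' γ : Γ, Real.exp (-Real.pi * α * (x - γ) ^ 2)

/-- The maximum of `p_α` over the real line. -/
def maxGaussianSum (α : ℝ) (Γ : Set ℝ) : ℝ := ⨆ x : ℝ, gaussianSum α Γ x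

/-- The (real-valued) theta function `θ_α(x) = ∑_{k ∈ ℤ} exp (-π α k²) exp (2 π i k x)` on the
torus `ℝ / ℤ`; here `fourier k x = exp (2 π i k x)`. -/
def theta (α : ℝ) (x : UnitAddCircle) : ℝ :=
  (∑' k : ℤ, (Real.exp (-Real.pi * α * (k : ℝ) ^ 2) : ℂ) * fourier k x).re

/-- For `α > 0` the series that defines `θ_α(x)` converges and its sum is real, so that taking the
real part in the definition changes nothing. -/
theorem hasSum_theta {α : ℝ} (hα : 0 < α) (x : UnitAddCircle) :
    HasSum (fun k : ℤ => (Real.exp (-Real.pi * α * (k : ℝ) ^ 2) : ℂ) * fourier k x)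
      (theta α x : ℂ) := by
  have hs : Summable (fun k : ℤ =>
      (Real.exp (-Real.pi * α * (k : ℝ) ^ 2) : ℂ) * fourier k x) := by
    induction x using QuotientAddGroup.induction_on with
    | H x =>
      have h := (summable_jacobiTheta₂_term_iff (x : ℂ) (Complex.I * (α : ℂ))).2 (by simpa using hα)
      refine h.congr fun k => ?_
      rw [fourier_coe_apply, jacobiTheta₂_term, Complex.ofReal_exp, ← Complex.exp_add]
      congr 1
      push_cast
      linear_combination ((Real.pi : ℂ) * α * (k : ℂ) ^ 2) * Complex.I_sq
  have hc : (starRingEnd ℂ)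
      (∑' k : ℤ, (Real.exp (-Real.pi * α * (k : ℝ) ^ 2) : ℂ) * fourier k x) =
      ∑' k : ℤ, (Real.exp (-Real.pi * α * (k : ℝ) ^ 2) : ℂ) * fourier k x := by
    rw [Complex.conj_tsum, ← (Equiv.neg ℤ).tsum_eq]
    refine tsum_congr fun k => ?_
    rw [map_mul, Complex.conj_ofReal, Equiv.neg_apply, ← fourier_neg, neg_neg]
    push_cast
    rw [neg_sq]
  have hr : ((theta α x : ℝ) : ℂ) =
      ∑' k : ℤ, (Real.exp (-Real.pi * α * (k : ℝ) ^ 2) : ℂ) * fourier k x :=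
    Complex.conj_eq_iff_re.1 hc
  rw [hr]
  exact hs.hasSum

/-- `f_α(x) = ∑_j θ_α(x - x_j)` for a finite set `S = {x_1, …, x_n}` of points on the torus. -/
def thetaSum (α : ℝ) (S : Finset UnitAddCircle) (x : UnitAddCircle) : ℝ :=
  ∑ y ∈ S, theta α (x - y)

/-- The maximum of `f_α` over the torus. -/
def maxThetaSum (α : ℝ) (S : Finset UnitAddCircle) : ℝ := ⨆ x : UnitAddCircle, thetaSum α S x

/-- `S` is a set of `n` equispaced points on the torus: `{z, z + 1/n, …, z + (n-1)/n}` for some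
`z`. -/
def IsEquispacedTorus (n : ℕ) (S : Finset UnitAddCircle) : Prop :=
  ∃ z : UnitAddCircle,
    (S : Set UnitAddCircle) = Set.range fun j : Fin n => z + (((j : ℝ) / n : ℝ) : UnitAddCircle)

end

/-! On the torus, the maximum of the potential is at least its average over the points $x_i$, which
is $\frac1n\sum_{i,j}\theta_\alpha(x_i-x_j)$. Equispaced points minimise this energy, strictly
(`exists_energyDefect_theta_ge`). For them the average is the maximum itself, because all Fourier
coefficients of $\theta_\alpha$ are positive (`sum_theta_sub_div_le`).

For the energy, the Jacobi triple product makes $\theta_\alpha(t)$ a limit of products of factors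
$A+B(2\cos\pi t)^2$ with $A,B\ge0$, so the potentials $(2\cos\pi t)^{2k}$ suffice. Put $N=n-1$ and
$X=2\cos\pi t$. Every $X^{2k}$ is a nonnegative combination of $S_a$, $S_NS_b$ with $a,b<N$, and
$S_N^2X^q$, with even total degrees. The first two kinds expand in $\cos 2\pi lt$ with $0\le l<n$;
for $0<l<n$ the energy is a squared modulus, and equispaced points make it zero. The third kind is
nonnegative and vanishes at $t=j/n$, $0<j<n$. Strictness comes from the term $S_N^2$ in $X^{2N}$,
which vanishes at a noninteger $t$ only if $nt\in\mathbb Z$.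

Poisson summation turns a Gaussian sum over a periodic set into a potential on the torus, which
carries the result to the line. -/

/-! ### Chebyshev polynomials and the cone containing the powers of $X$ -/

open Polynomial in
/-- Products of (rescaled) Chebyshev polynomials of the second kind expand in such polynomials. -/
theorem chebyshevS_mul_chebyshevS (q : ℕ) : ∀ p : ℤ,
    Chebyshev.S ℝ p * Chebyshev.S ℝ q =
      ∑ i ∈ Finset.range (q + 1), Chebyshev.S ℝ (p + q - 2 * i) := by
  induction q using Nat.twoStepInduction with
  | zero => intro p; simp
  | one =>
    intro p
    have h := Chebyshev.S_add_one ℝ p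
    simp only [Nat.cast_one, Chebyshev.S_one, Finset.sum_range_succ, Finset.sum_range_zero]
    rw [show p + 1 - 2 * ((0 : ℕ) : ℤ) = p + 1 by simp,
      show p + 1 - 2 * 1 = p - 1 by ring]
    linear_combination -h
  | more q ih0 ih1 =>
    intro p
    have h1 : Chebyshev.S ℝ p * Chebyshev.S ℝ ((q + 2 : ℕ) : ℤ) =
        Chebyshev.S ℝ (p + 1) * Chebyshev.S ℝ ((q + 1 : ℕ) : ℤ) +
          Chebyshev.S ℝ (p - 1) * Chebyshev.S ℝ ((q + 1 : ℕ) : ℤ) -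
          Chebyshev.S ℝ p * Chebyshev.S ℝ (q : ℤ) := by
      have e1 := Chebyshev.S_add_two ℝ (q : ℤ)
      have e2 := Chebyshev.S_add_one ℝ p
      push_cast
      rw [e1]
      linear_combination (-Chebyshev.S ℝ ((q : ℤ) + 1)) * e2
    rw [h1, ih1, ih1, ih0, Finset.sum_range_succ _ (q + 1 + 1),
      Finset.sum_range_succ (fun i : ℕ => Chebyshev.S ℝ (p - 1 + ((q + 1 : ℕ) : ℤ) - 2 * (i : ℤ)))]
    have e3 : ∑ i ∈ Finset.range (q + 1), Chebyshev.S ℝ (p - 1 + ((q + 1 : ℕ) : ℤ) - 2 * (i : ℤ)) =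
        ∑ i ∈ Finset.range (q + 1), Chebyshev.S ℝ (p + (q : ℤ) - 2 * (i : ℤ)) :=
      Finset.sum_congr rfl fun i _ => by congr 1; push_cast; ring
    have e4 : ∑ i ∈ Finset.range (q + 1 + 1),
        Chebyshev.S ℝ (p + 1 + ((q + 1 : ℕ) : ℤ) - 2 * (i : ℤ)) =
        ∑ i ∈ Finset.range (q + 1 + 1), Chebyshev.S ℝ (p + ((q + 2 : ℕ) : ℤ) - 2 * (i : ℤ)) :=
      Finset.sum_congr rfl fun i _ => by congr 1; push_cast; ring
    rw [e3, e4, show p - 1 + ((q + 1 : ℕ) : ℤ) - 2 * ((q + 1 : ℕ) : ℤ) =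
      p + ((q + 2 : ℕ) : ℤ) - 2 * ((q + 1 + 1 : ℕ) : ℤ) by push_cast; ring]
    ring

open Polynomial in
/-- The generators, of the parity of `m`, of the cone of polynomials on which the energy is
minimised by `N + 1` equispaced points. -/
inductive IsEnergyGenerator (N m : ℕ) : ℝ[X] → Prop
  | single (a : ℕ) (ha : a < N) (h : (a + m) % 2 = 0) :
      IsEnergyGenerator N m (Chebyshev.S ℝ a)
  | mixed (b : ℕ) (hb : b < N) (h : (N + b + m) % 2 = 0) :
      IsEnergyGenerator N m (Chebyshev.S ℝ N * Chebyshev.S ℝ b)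
  | square (q : ℕ) (h : (q + m) % 2 = 0) :
      IsEnergyGenerator N m (Chebyshev.S ℝ N ^ 2 * X ^ q)

open Polynomial in
/-- The cone generated by `IsEnergyGenerator`. -/
noncomputable def energyCone (N m : ℕ) : AddSubmonoid ℝ[X] := AddSubmonoid.closure {p | IsEnergyGenerator N m p}

open Polynomial in
-- The end case `a = N` is the `mixed` generator $S_NS_0$, or, when $N=0$, the `square` generator
-- $S_0^2X^0$.
theorem chebyshevS_mem_energyCone {N m a : ℕ} (ha : a ≤ N) (h : (a + m) % 2 = 0) :
    Chebyshev.S ℝ a ∈ energyCone N m := by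
  refine AddSubmonoid.subset_closure ?_
  rcases ha.lt_or_eq with ha | rfl
  · exact .single a ha h
  · rcases Nat.eq_zero_or_pos a with rfl | h0
    · simpa using IsEnergyGenerator.square (N := 0) (m := m) 0 (by simpa using h)
    · simpa using IsEnergyGenerator.mixed (N := a) (m := m) 0 h0 (by simpa using h)

open Polynomial in
theorem chebyshevS_mul_mem_energyCone {N m b : ℕ} (hb : b ≤ N) (h : (N + b + m) % 2 = 0) :
    Chebyshev.S ℝ N * Chebyshev.S ℝ b ∈ energyCone N m := by
  refine AddSubmonoid.subset_closure ?_
  rcases hb.lt_or_eq with hb | rfl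
  · exact .mixed b hb h
  · simpa [pow_two] using IsEnergyGenerator.square (N := b) (m := m) 0 (by omega)

open Polynomial in
theorem X_mul_chebyshevS_zero : X * Chebyshev.S ℝ ((0 : ℕ) : ℤ) = Chebyshev.S ℝ ((0 + 1 : ℕ) : ℤ) := by
  simp

open Polynomial in
theorem X_mul_chebyshevS_succ (a : ℕ) : X * Chebyshev.S ℝ ((a + 1 : ℕ) : ℤ) =
    Chebyshev.S ℝ ((a + 1 + 1 : ℕ) : ℤ) + Chebyshev.S ℝ (a : ℤ) := by
  have := Chebyshev.S_add_two ℝ (a : ℤ)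
  push_cast
  rw [add_assoc, one_add_one_eq_two, this]
  ring

open Polynomial in
-- Since $XS_a=S_{a+1}+S_{a-1}$, multiplication by $X$ raises an index by at most one. On reaching
-- $N$, the product passes to the next kind of generator.
theorem X_mul_mem_energyCone {N m : ℕ} {p : ℝ[X]} (hp : p ∈ energyCone N m) :
    X * p ∈ energyCone N (m + 1) := by
  induction hp using AddSubmonoid.closure_induction with
  | zero => simp
  | add p q _ _ hp hq => rw [mul_add]; exact add_mem hp hq
  | mem p hp =>
    rcases hp with ⟨a, ha, h⟩ | ⟨b, hb, h⟩ | ⟨q, h⟩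
    · rcases a with _ | a
      · rw [X_mul_chebyshevS_zero]
        exact chebyshevS_mem_energyCone (by omega) (by omega)
      · rw [X_mul_chebyshevS_succ]
        exact add_mem (chebyshevS_mem_energyCone (by omega) (by omega))
          (chebyshevS_mem_energyCone (by omega) (by omega))
    · rw [mul_left_comm]
      rcases b with _ | b
      · rw [X_mul_chebyshevS_zero]
        exact chebyshevS_mul_mem_energyCone (by omega) (by omega)
      · rw [X_mul_chebyshevS_succ, mul_add]
        exact add_mem (chebyshevS_mul_mem_energyCone (by omega) (by omega))
          (chebyshevS_mul_mem_energyCone (by omega) (by omega))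
    · rw [mul_left_comm, ← pow_succ']
      exact AddSubmonoid.subset_closure (.square (q + 1) (by omega))

open Polynomial in
theorem X_pow_mem_energyCone (N m : ℕ) : (X ^ m : ℝ[X]) ∈ energyCone N m := by
  induction m with
  | zero => simpa using chebyshevS_mem_energyCone (N := N) (m := 0) (Nat.zero_le N) rfl
  | succ m ih => rw [pow_succ']; exact X_mul_mem_energyCone ih

open Polynomial in
-- The leading term is kept apart so that $S_N^2$ can be exhibited in $X^{2N}$; strict optimality
-- rests on it.
theorem exists_X_pow_eq_chebyshevS_add (N m : ℕ) (hm : m ≤ N) :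
    ∃ p ∈ energyCone N m, (X ^ m : ℝ[X]) = Chebyshev.S ℝ m + p := by
  induction m with
  | zero => exact ⟨0, zero_mem _, by simp⟩
  | succ m ih =>
    obtain ⟨p, hp, h⟩ := ih (by omega)
    rw [pow_succ', h, mul_add]
    rcases m with _ | m
    · exact ⟨X * p, X_mul_mem_energyCone hp, by rw [X_mul_chebyshevS_zero]⟩
    · exact ⟨Chebyshev.S ℝ m + X * p, add_mem (chebyshevS_mem_energyCone (by omega) (by omega))
        (X_mul_mem_energyCone hp), by rw [X_mul_chebyshevS_succ]; ring⟩

open Polynomial in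
theorem exists_X_pow_eq_chebyshevS_mul_add (N b : ℕ) (hb : b ≤ N) :
    ∃ p ∈ energyCone N (N + b),
      (X ^ (N + b) : ℝ[X]) = Chebyshev.S ℝ N * Chebyshev.S ℝ b + p := by
  induction b with
  | zero => simpa using exists_X_pow_eq_chebyshevS_add N N le_rfl
  | succ b ih =>
    obtain ⟨p, hp, h⟩ := ih (by omega)
    rw [← add_assoc, pow_succ', h, mul_add, mul_left_comm]
    rcases b with _ | b
    · exact ⟨X * p, X_mul_mem_energyCone hp, by rw [X_mul_chebyshevS_zero]⟩
    · exact ⟨Chebyshev.S ℝ N * Chebyshev.S ℝ b + X * p,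
        add_mem (chebyshevS_mul_mem_energyCone (by omega) (by omega))
        (X_mul_mem_energyCone hp), by rw [X_mul_chebyshevS_succ]; ring⟩

/-! ### Energy of polynomial potentials in $2\cos\pi t$ -/

/-- The excess of the energy of the points `x` over that of `n` equispaced points, as a linear
functional of the potential `g`. -/
noncomputable def energyDefect {n : ℕ} (x : Fin n → ℝ) : (ℝ → ℝ) →ₗ[ℝ] ℝ where
  toFun g := ∑ i, ∑ j, g (x i - x j) - n * ∑ j : Fin n, g ((j : ℝ) / n)
  map_add' f g := by simp only [Pi.add_apply, Finset.sum_add_distrib]; ring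
  map_smul' c g := by
    simp only [Pi.smul_apply, smul_eq_mul, RingHom.id_apply, ← Finset.mul_sum]; ring

theorem energyDefect_apply {n : ℕ} (x : Fin n → ℝ) (g : ℝ → ℝ) :
    energyDefect x g = ∑ i, ∑ j, g (x i - x j) - n * ∑ j : Fin n, g ((j : ℝ) / n) := rfl

open Complex in
theorem exp_int_div_eq_one_iff {n : ℕ} (hn : 0 < n) (k : ℤ) :
    exp (2 * Real.pi * I * k / n) = 1 ↔ (n : ℤ) ∣ k := by
  have hn' : (n : ℂ) ≠ 0 := by exact_mod_cast hn.ne'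
  rw [Complex.exp_eq_one_iff]
  constructor
  · rintro ⟨m, hm⟩
    refine ⟨m, ?_⟩
    have : (k : ℂ) = n * m := by
      rw [div_eq_iff hn'] at hm
      exact mul_left_cancel₀ Complex.two_pi_I_ne_zero (by linear_combination hm)
    exact_mod_cast this
  · rintro ⟨m, rfl⟩
    exact ⟨m, by push_cast; field_simp⟩

open Complex in
/-- The sum of a character over the group of `n`-th roots of unity. -/
theorem sum_exp_int_div {n : ℕ} (hn : 0 < n) (k : ℤ) :
    ∑ j : Fin n, exp (2 * Real.pi * I * k * ((j : ℝ) / n : ℝ)) = if (n : ℤ) ∣ k then (n : ℂ) else 0 := by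
  have hn' : (n : ℂ) ≠ 0 := by exact_mod_cast hn.ne'
  set ζ := exp (2 * Real.pi * I * k / n) with hζ
  have h1 : ∀ j : Fin n, exp (2 * Real.pi * I * k * ((j : ℝ) / n : ℝ)) = ζ ^ (j : ℕ) := by
    intro j
    rw [hζ, ← Complex.exp_nat_mul]
    congr 1
    push_cast
    ring
  simp_rw [h1]
  rw [Fin.sum_univ_eq_sum_range (fun j => ζ ^ j)]
  split_ifs with h
  · rw [(exp_int_div_eq_one_iff hn k).2 h] at hζ
    simp [hζ]
  · have h2 : ζ ≠ 1 := fun h3 => h ((exp_int_div_eq_one_iff hn k).1 h3)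
    have h3 : ζ ^ n = 1 := by
      rw [hζ, ← Complex.exp_nat_mul, Complex.exp_eq_one_iff]
      exact ⟨k, by field_simp⟩
    rw [geom_sum_eq h2, h3, sub_self, zero_div]

theorem sum_cos_int_div {n : ℕ} (hn : 0 < n) (k : ℤ) :
    ∑ j : Fin n, Real.cos (2 * Real.pi * k * ((j : ℝ) / n)) = if (n : ℤ) ∣ k then (n : ℝ) else 0 := by
  have h := congrArg Complex.re (sum_exp_int_div hn k)
  rw [Complex.re_sum] at h
  have h2 : ∀ j : Fin n, (Complex.exp (2 * Real.pi * Complex.I * k * ((j : ℝ) / n : ℝ))).re =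
      Real.cos (2 * Real.pi * k * ((j : ℝ) / n)) := by
    intro j
    rw [← Complex.exp_ofReal_mul_I_re]
    congr 2
    push_cast
    ring
  simp_rw [h2] at h
  rw [h]
  split_ifs <;> simp

/-- The double sum is $|\sum_i e^{2\pi i l x_i}|^2$, and the sum over equispaced points vanishes for
$0<l<n$. For $l=0$ both energies are $n^2$. -/
theorem energyDefect_cos_nonneg {n : ℕ} (x : Fin n → ℝ) (l : ℕ) (hl : l < n) :
    0 ≤ energyDefect x fun t => Real.cos (2 * Real.pi * l * t) := by
  have hn : 0 < n := by omega
  have h := sum_cos_int_div hn l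
  rw [energyDefect_apply]
  simp only [Int.cast_natCast] at h
  rw [h]
  split_ifs with hd
  · have h0 : l = 0 := Nat.eq_zero_of_dvd_of_lt (Int.natCast_dvd_natCast.1 hd) hl
    simp [h0]
  · have : ∑ i, ∑ j, Real.cos (2 * Real.pi * l * (x i - x j)) =
        (∑ i, Real.cos (2 * Real.pi * l * x i)) ^ 2 +
        (∑ i, Real.sin (2 * Real.pi * l * x i)) ^ 2 := by
      simp only [pow_two, Finset.sum_mul_sum, ← Finset.sum_add_distrib]
      refine Finset.sum_congr rfl fun i _ => Finset.sum_congr rfl fun j _ => ?_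
      rw [mul_sub, Real.cos_sub]
    rw [this, mul_zero, sub_zero]
    positivity

open Polynomial in
/-- The substitution of `2 cos (π t)` into a polynomial. -/
noncomputable def evalTwoCos : ℝ[X] →ₗ[ℝ] (ℝ → ℝ) where
  toFun p t := p.eval (2 * Real.cos (Real.pi * t))
  map_add' p q := by ext; simp
  map_smul' c p := by ext; simp

open Polynomial in
theorem evalTwoCos_apply (p : ℝ[X]) (t : ℝ) :
    evalTwoCos p t = p.eval (2 * Real.cos (Real.pi * t)) := rfl

open Polynomial in
-- $S_{2b}(2\cos\pi t)$ is the Dirichlet kernel $1+2\sum_{l=1}^b\cos 2\pi lt$, all of whose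
-- frequencies are below $n$.
theorem energyDefect_chebyshevS_nonneg {n : ℕ} (x : Fin n → ℝ) (b : ℕ) (hb : b < n) :
    0 ≤ energyDefect x (evalTwoCos (Chebyshev.S ℝ (2 * b : ℕ))) := by
  induction b with
  | zero =>
    convert energyDefect_cos_nonneg x 0 hb using 2
    ext t
    simp [evalTwoCos_apply]
  | succ b ih =>
    have h1 : Chebyshev.S ℝ (2 * (b + 1) : ℕ) =
        Chebyshev.S ℝ (2 * b : ℕ) + Chebyshev.C ℝ (2 * (b + 1) : ℕ) := by
      have e1 := Chebyshev.S_eq_X_mul_S_add_C ℝ ((2 * b : ℕ) + 1 : ℤ)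
      have e2 := Chebyshev.S_add_two ℝ ((2 * b : ℕ) : ℤ)
      rw [show ((2 * (b + 1) : ℕ) : ℤ) = (2 * b : ℕ) + 1 + 1 by push_cast; ring]
      rw [add_assoc, one_add_one_eq_two] at e1 ⊢
      linear_combination e1 - e2
    have h2 : evalTwoCos (Chebyshev.C ℝ (2 * (b + 1) : ℕ)) =
        (2 : ℝ) • fun t => Real.cos (2 * Real.pi * (b + 1 : ℕ) * t) := by
      ext t
      rw [evalTwoCos_apply, Chebyshev.C_two_mul_real_cos, Pi.smul_apply, smul_eq_mul]
      congr 2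
      push_cast
      ring
    rw [h1, map_add, map_add, h2, map_smul]
    exact add_nonneg (ih (by omega))
      (smul_nonneg zero_le_two (energyDefect_cos_nonneg x (b + 1) hb))

/-- From $S_N(2\cos\theta)\sin\theta=\sin((N+1)\theta)$ at $\theta=\pi j/(N+1)$, where
$\sin\theta>0$. -/
theorem chebyshevS_eval_two_cos_eq_zero {N j : ℕ} (h0 : 0 < j) (hj : j < N + 1) :
    (Polynomial.Chebyshev.S ℝ N).eval (2 * Real.cos (Real.pi * ((j : ℝ) / (N + 1 : ℕ)))) = 0 := by
  have h := Polynomial.Chebyshev.S_two_mul_real_cos (Real.pi * ((j : ℝ) / (N + 1 : ℕ))) N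
  have hN : (0 : ℝ) < (N + 1 : ℕ) := by positivity
  have h1 : Real.sin (((N : ℤ) + 1 : ℝ) * (Real.pi * ((j : ℝ) / (N + 1 : ℕ)))) = 0 := by
    rw [← Real.sin_nat_mul_pi j]
    congr 1
    push_cast
    field_simp
  have h2 : 0 < Real.sin (Real.pi * ((j : ℝ) / (N + 1 : ℕ))) := by
    apply Real.sin_pos_of_pos_of_lt_pi
    · positivity
    · have : (j : ℝ) / (N + 1 : ℕ) < 1 := by
        rw [div_lt_one hN]
        exact_mod_cast hj
      nlinarith [Real.pi_pos]
  rw [h1] at h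
  exact (mul_eq_zero.1 h).resolve_right h2.ne'

open Polynomial in
/-- For a potential `S_N² g`, only the diagonal contributes to the energy of equispaced points. -/
theorem energyDefect_chebyshevS_sq_mul {N : ℕ} (x : Fin (N + 1) → ℝ) (p : ℝ[X]) :
    energyDefect x (evalTwoCos (Chebyshev.S ℝ N ^ 2 * p)) =
      ∑ i, ∑ j ∈ Finset.univ.erase i, evalTwoCos (Chebyshev.S ℝ N ^ 2 * p) (x i - x j) := by
  have h1 : ∑ j : Fin (N + 1),
      evalTwoCos (Chebyshev.S ℝ N ^ 2 * p) ((j : ℝ) / ((N + 1 : ℕ) : ℝ)) =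
      evalTwoCos (Chebyshev.S ℝ N ^ 2 * p) 0 := by
    rw [Finset.sum_eq_single 0]
    · simp
    · intro j _ hj
      rw [evalTwoCos_apply, eval_mul, eval_pow, chebyshevS_eval_two_cos_eq_zero _ j.2]
      · simp
      · exact Nat.pos_of_ne_zero fun h => hj (Fin.ext h)
    · simp
  have h2 : ∀ i, ∑ j, evalTwoCos (Chebyshev.S ℝ N ^ 2 * p) (x i - x j) =
      evalTwoCos (Chebyshev.S ℝ N ^ 2 * p) 0 +
      ∑ j ∈ Finset.univ.erase i, evalTwoCos (Chebyshev.S ℝ N ^ 2 * p) (x i - x j) := by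
    intro i
    rw [← Finset.add_sum_erase _ _ (Finset.mem_univ i), sub_self]
  rw [energyDefect_apply, h1]
  simp_rw [h2]
  rw [Finset.sum_add_distrib]
  simp

open Polynomial in
theorem energyDefect_nonneg_of_mem_energyCone {N m : ℕ} (x : Fin (N + 1) → ℝ) (hm : m % 2 = 0)
    {p : ℝ[X]} (hp : p ∈ energyCone N m) : 0 ≤ energyDefect x (evalTwoCos p) := by
  induction hp using AddSubmonoid.closure_induction with
  | zero => simp
  | add p q _ _ hp hq => rw [map_add, map_add]; exact add_nonneg hp hq
  | mem p hp =>
    rcases hp with ⟨a, ha, h⟩ | ⟨b, hb, h⟩ | ⟨q, h⟩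
    · obtain ⟨c, rfl⟩ : ∃ c, a = 2 * c := ⟨a / 2, by omega⟩
      exact energyDefect_chebyshevS_nonneg x c (by omega)
    -- The indices $N+b-2i$ are even and positive, and $b<N$ keeps them below $2N$, so only
    -- frequencies below $n=N+1$ occur.
    · rw [chebyshevS_mul_chebyshevS, map_sum, map_sum]
      refine Finset.sum_nonneg fun i hi => ?_
      rw [Finset.mem_range] at hi
      obtain ⟨c, hc⟩ : ∃ c : ℕ, (N : ℤ) + b - 2 * i = (2 * c : ℕ) :=
        ⟨(N + b - 2 * i) / 2, by omega⟩
      rw [hc]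
      exact energyDefect_chebyshevS_nonneg x c (by omega)
    · rw [energyDefect_chebyshevS_sq_mul]
      refine Finset.sum_nonneg fun i _ => Finset.sum_nonneg fun j _ => ?_
      rw [evalTwoCos_apply, eval_mul, eval_pow, eval_pow, eval_X]
      exact mul_nonneg (sq_nonneg _) (Even.pow_nonneg (Nat.even_iff.2 (by omega)) _)

open Polynomial in
theorem energyDefect_two_cos_pow_nonneg {n : ℕ} (hn : 0 < n) (x : Fin n → ℝ) (k : ℕ) :
    0 ≤ energyDefect x fun t => (2 * Real.cos (Real.pi * t)) ^ (2 * k) := by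
  obtain ⟨N, rfl⟩ : ∃ N, n = N + 1 := ⟨n - 1, by omega⟩
  have h := energyDefect_nonneg_of_mem_energyCone x (by omega) (X_pow_mem_energyCone N (2 * k))
  convert h using 2
  ext t
  simp [evalTwoCos_apply]

open Polynomial in
theorem energyDefect_two_cos_pow_pos {n : ℕ} (hn : 0 < n) (x : Fin n → ℝ)
    {i j : Fin n} (hij : ∀ m : ℤ, (n : ℝ) * (x i - x j) ≠ m) :
    0 < energyDefect x fun t => (2 * Real.cos (Real.pi * t)) ^ (2 * (n - 1)) := by
  obtain ⟨N, rfl⟩ : ∃ N, n = N + 1 := ⟨n - 1, by omega⟩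
  obtain ⟨p, hp, h⟩ := exists_X_pow_eq_chebyshevS_mul_add N N le_rfl
  have h1 := energyDefect_nonneg_of_mem_energyCone x (by omega) hp
  have h2 : (fun t => (2 * Real.cos (Real.pi * t)) ^ (2 * (N + 1 - 1))) =
      evalTwoCos (Chebyshev.S ℝ N ^ 2 * 1) + evalTwoCos p := by
    rw [← map_add, mul_one, pow_two, ← h]
    ext t
    simp [evalTwoCos_apply, two_mul]
  rw [h2, map_add, energyDefect_chebyshevS_sq_mul]
  refine add_pos_of_pos_of_nonneg ?_ h1
  have h3 : ∀ i j, 0 ≤ evalTwoCos (Chebyshev.S ℝ N ^ 2 * 1) (x i - x j) := fun i j => by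
    simp only [evalTwoCos_apply, mul_one, eval_pow]
    positivity
  refine Finset.sum_pos' (fun i _ => Finset.sum_nonneg fun j _ => h3 i j) ⟨i, Finset.mem_univ i, ?_⟩
  refine Finset.sum_pos' (fun j _ => h3 i j) ⟨j, ?_, (h3 i j).lt_of_ne' fun h4 => ?_⟩
  · refine Finset.mem_erase.2 ⟨?_, Finset.mem_univ j⟩
    rintro rfl
    exact hij 0 (by simp)
  · simp only [evalTwoCos_apply, mul_one, eval_pow] at h4
    -- A zero of $S_N$ at $2\cos\theta$ forces $\sin(n\theta)=0$, that is, $n(x_i-x_j)\in\mathbb Z$.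
    have h5 := Chebyshev.S_two_mul_real_cos (Real.pi * (x i - x j)) N
    rw [pow_eq_zero_iff two_ne_zero] at h4
    rw [h4, zero_mul, eq_comm, Real.sin_eq_zero_iff] at h5
    obtain ⟨m, hm⟩ := h5
    refine hij m (mul_right_cancel₀ Real.pi_ne_zero ?_)
    rw [hm]
    push_cast
    ring

/-! ### The Jacobi triple product -/

/-- The `q`-Pochhammer symbol `∏_{m < N} (1 - r^(m+1))`. -/
noncomputable def qPochhammer (r : ℝ) (N : ℕ) : ℝ := ∏ m ∈ Finset.range N, (1 - r ^ (m + 1))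

theorem qPochhammer_pos {r : ℝ} (h0 : 0 ≤ r) (h1 : r < 1) (N : ℕ) : 0 < qPochhammer r N :=
  Finset.prod_pos fun m _ => sub_pos.2 (pow_lt_one₀ h0 h1 (Nat.succ_ne_zero m))

theorem qPochhammer_succ (r : ℝ) (N : ℕ) :
    qPochhammer r (N + 1) = qPochhammer r N * (1 - r ^ (N + 1)) :=
  Finset.prod_range_succ _ _

theorem antitone_qPochhammer {r : ℝ} (h0 : 0 ≤ r) (h1 : r < 1) : Antitone (qPochhammer r) := by
  refine antitone_nat_of_succ_le fun N => ?_
  rw [qPochhammer_succ]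
  exact mul_le_of_le_one_right (qPochhammer_pos h0 h1 N).le (by linarith [pow_nonneg h0 (N + 1)])

theorem qPochhammer_le_one {r : ℝ} (h0 : 0 ≤ r) (h1 : r < 1) (N : ℕ) : qPochhammer r N ≤ 1 := by
  simpa [qPochhammer] using antitone_qPochhammer h0 h1 (Nat.zero_le N)

/-- With $y=r^{m+1}\le r$, one has $(1-y)^{-1}=1+\frac{y}{1-y}\le e^{y/(1-r)}$, and these exponents
are summable. -/
theorem exists_le_qPochhammer {r : ℝ} (h0 : 0 ≤ r) (h1 : r < 1) :
    ∃ c > 0, ∀ N, c ≤ qPochhammer r N := by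
  have h2 : 0 < 1 - r := sub_pos.2 h1
  have hs : Summable fun m : ℕ => r ^ (m + 1) / (1 - r) :=
    ((summable_geometric_of_lt_one h0 h1).comp_injective (add_left_injective 1)).div_const _
  refine ⟨Real.exp (-∑' m : ℕ, r ^ (m + 1) / (1 - r)), Real.exp_pos _, fun N => ?_⟩
  calc Real.exp (-∑' m : ℕ, r ^ (m + 1) / (1 - r))
      ≤ Real.exp (-∑ m ∈ Finset.range N, r ^ (m + 1) / (1 - r)) := by
        refine Real.exp_le_exp.2 (neg_le_neg (hs.sum_le_tsum _ fun m _ => ?_))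
        positivity
    _ = ∏ m ∈ Finset.range N, Real.exp (-(r ^ (m + 1) / (1 - r))) := by
        rw [← Finset.sum_neg_distrib, Real.exp_sum]
    _ ≤ qPochhammer r N := by
        refine Finset.prod_le_prod (fun m _ => (Real.exp_pos _).le) fun m _ => ?_
        have h3 : r ^ (m + 1) ≤ r := by
          simpa using pow_le_pow_of_le_one h0 h1.le (Nat.le_add_left 1 m)
        have h4 : 0 < 1 - r ^ (m + 1) := by linarith
        rw [Real.exp_neg, inv_le_comm₀ (Real.exp_pos _) h4]
        refine le_trans ?_ (Real.add_one_le_exp _)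
        have h5 : r ^ (m + 1) / (1 - r ^ (m + 1)) ≤ r ^ (m + 1) / (1 - r) := by gcongr
        have h6 : (1 - r ^ (m + 1))⁻¹ = r ^ (m + 1) / (1 - r ^ (m + 1)) + 1 := by
          field_simp; ring
        linarith

theorem exists_tendsto_qPochhammer {r : ℝ} (h0 : 0 ≤ r) (h1 : r < 1) :
    ∃ L > 0, Filter.Tendsto (qPochhammer r) Filter.atTop (nhds L) := by
  obtain ⟨c, hc, h⟩ := exists_le_qPochhammer h0 h1
  have hb : BddBelow (Set.range (qPochhammer r)) := ⟨c, by rintro _ ⟨N, rfl⟩; exact h N⟩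
  exact ⟨_, hc.trans_le (le_ciInf h), tendsto_atTop_ciInf (antitone_qPochhammer h0 h1) hb⟩

/-- The reciprocal of the `q`-Pochhammer symbol, extended by zero to negative indices. -/
noncomputable def invQPochhammer (r : ℝ) (j : ℤ) : ℝ := if j < 0 then 0 else (qPochhammer r j.toNat)⁻¹

theorem invQPochhammer_of_neg (r : ℝ) {j : ℤ} (hj : j < 0) : invQPochhammer r j = 0 := if_pos hj

theorem invQPochhammer_natCast (r : ℝ) (j : ℕ) : invQPochhammer r j = (qPochhammer r j)⁻¹ := by
  simp [invQPochhammer]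

/-- Extension by zero keeps the recursion valid at all integers, because $1-r^j$ vanishes at $j=0$.
-/
theorem invQPochhammer_sub_one {r : ℝ} (h0 : 0 ≤ r) (h1 : r < 1) (j : ℤ) :
    invQPochhammer r (j - 1) = (1 - r ^ j) * invQPochhammer r j := by
  rcases lt_trichotomy j 0 with hj | rfl | hj
  · rw [invQPochhammer_of_neg r hj, invQPochhammer_of_neg r (by omega), mul_zero]
  · rw [invQPochhammer_of_neg r (by omega)]; simp
  · obtain ⟨m, rfl⟩ : ∃ m : ℕ, j = (m + 1 : ℕ) := ⟨(j - 1).toNat, by omega⟩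
    rw [show ((m + 1 : ℕ) : ℤ) - 1 = (m : ℕ) by push_cast; ring, invQPochhammer_natCast,
      invQPochhammer_natCast, qPochhammer_succ, zpow_natCast]
    have h2 := (qPochhammer_pos h0 h1 m).ne'
    have h3 : 1 - r ^ (m + 1) ≠ 0 := (sub_pos.2 (pow_lt_one₀ h0 h1 (Nat.succ_ne_zero m))).ne'
    field_simp

theorem invQPochhammer_nonneg {r : ℝ} (h0 : 0 ≤ r) (h1 : r < 1) (j : ℤ) :
    0 ≤ invQPochhammer r j := by
  rw [invQPochhammer]
  split_ifs
  · exact le_rfl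
  · exact (inv_pos.2 (qPochhammer_pos h0 h1 _)).le

theorem invQPochhammer_le {r c : ℝ} (hc : 0 < c) (h : ∀ N, c ≤ qPochhammer r N) (j : ℤ) :
    invQPochhammer r j ≤ c⁻¹ := by
  rw [invQPochhammer]
  split_ifs
  · positivity
  · exact inv_anti₀ hc (h _)

theorem tendsto_invQPochhammer {r L : ℝ} (hL : L ≠ 0)
    (h : Filter.Tendsto (qPochhammer r) Filter.atTop (nhds L)) :
    Filter.Tendsto (invQPochhammer r) Filter.atTop (nhds L⁻¹) := by
  have h1 : Filter.Tendsto (fun j : ℤ => (qPochhammer r j.toNat)⁻¹) Filter.atTop (nhds L⁻¹) := by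
    have h2 : Filter.Tendsto Int.toNat Filter.atTop Filter.atTop :=
      Filter.tendsto_atTop_atTop.2 fun b => ⟨b, fun a ha => by omega⟩
    exact (h.comp h2).inv₀ hL
  refine h1.congr' ?_
  filter_upwards [Filter.eventually_ge_atTop 0] with j hj
  rw [invQPochhammer, if_neg hj.not_gt]

/-- The coefficients of the finite form of the Jacobi triple product. -/
noncomputable def tripleProductCoeff (q : ℝ) (N : ℕ) (k : ℤ) : ℝ :=
  q ^ (k ^ 2) * qPochhammer (q ^ 2) (2 * N) *
    (invQPochhammer (q ^ 2) (N - k) * invQPochhammer (q ^ 2) (N + k))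

/-- This is multiplication of $\sum_k c_kw^k$ by $(1+aw)(1+aw^{-1})=1+a^2+a(w+w^{-1})$, where
$a=q^{2N+1}$. -/
theorem tripleProductCoeff_succ {q : ℝ} (h0 : 0 < q) (h1 : q < 1) (N : ℕ) (k : ℤ) :
    tripleProductCoeff q (N + 1) k = (1 + q ^ (4 * N + 2)) * tripleProductCoeff q N k +
      q ^ (2 * N + 1) * (tripleProductCoeff q N (k - 1) + tripleProductCoeff q N (k + 1)) := by
  have hq0 : 0 ≤ q ^ 2 := sq_nonneg q
  have hq1 : q ^ 2 < 1 := pow_lt_one₀ h0.le h1 two_ne_zero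
  have hq : q ≠ 0 := h0.ne'
  have hR := invQPochhammer_sub_one hq0 hq1
  -- All reciprocals are written as multiples of the two with indices $N+1\mp k$, so no possibly
  -- vanishing factor is divided by. What remains is a rational identity in $q$, $y=q^{2k}$ and
  -- $Z=q^{2N}$.
  set u := invQPochhammer (q ^ 2) ((N : ℤ) + 1 - k) with hu
  set v := invQPochhammer (q ^ 2) ((N : ℤ) + 1 + k) with hv
  have a1 : invQPochhammer (q ^ 2) ((N : ℤ) - k) = (1 - (q ^ 2) ^ ((N : ℤ) + 1 - k)) * u := by
    rw [← hR]; congr 1; ring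
  have a2 : invQPochhammer (q ^ 2) ((N : ℤ) + k) = (1 - (q ^ 2) ^ ((N : ℤ) + 1 + k)) * v := by
    rw [← hR]; congr 1; ring
  have a3 : invQPochhammer (q ^ 2) ((N : ℤ) - (k + 1)) =
      (1 - (q ^ 2) ^ ((N : ℤ) - k)) * ((1 - (q ^ 2) ^ ((N : ℤ) + 1 - k)) * u) := by
    rw [← a1, ← hR]; congr 1; ring
  have a4 : invQPochhammer (q ^ 2) ((N : ℤ) + (k - 1)) =
      (1 - (q ^ 2) ^ ((N : ℤ) + k)) * ((1 - (q ^ 2) ^ ((N : ℤ) + 1 + k)) * v) := by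
    rw [← a2, ← hR]; congr 1; ring
  have a5 : invQPochhammer (q ^ 2) ((N : ℤ) - (k - 1)) = u := by rw [hu]; congr 1; ring
  have a6 : invQPochhammer (q ^ 2) ((N : ℤ) + (k + 1)) = v := by rw [hv]; congr 1; ring
  have b1 : q ^ ((k - 1) ^ 2) = q ^ (k ^ 2) * q * ((q ^ 2) ^ k)⁻¹ := by
    rw [← zpow_natCast q 2, ← zpow_mul, ← zpow_neg, ← zpow_add_one₀ hq, ← zpow_add₀ hq]
    congr 1; push_cast; ring
  have b2 : q ^ ((k + 1) ^ 2) = q ^ (k ^ 2) * q * (q ^ 2) ^ k := by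
    rw [← zpow_natCast q 2, ← zpow_mul, ← zpow_add_one₀ hq, ← zpow_add₀ hq]
    congr 1; push_cast; ring
  have hQ : q ^ 2 ≠ 0 := pow_ne_zero 2 hq
  have hy : (q ^ 2) ^ k ≠ 0 := zpow_ne_zero k hQ
  have c1 : (q ^ 2) ^ ((N : ℤ) + 1 - k) = (q ^ 2) ^ N * q ^ 2 * ((q ^ 2) ^ k)⁻¹ := by
    rw [zpow_sub₀ hQ, zpow_add_one₀ hQ, zpow_natCast, div_eq_mul_inv]
  have c2 : (q ^ 2) ^ ((N : ℤ) + 1 + k) = (q ^ 2) ^ N * q ^ 2 * (q ^ 2) ^ k := by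
    rw [zpow_add₀ hQ, zpow_add_one₀ hQ, zpow_natCast]
  have c3 : (q ^ 2) ^ ((N : ℤ) - k) = (q ^ 2) ^ N * ((q ^ 2) ^ k)⁻¹ := by
    rw [zpow_sub₀ hQ, zpow_natCast, div_eq_mul_inv]
  have c4 : (q ^ 2) ^ ((N : ℤ) + k) = (q ^ 2) ^ N * (q ^ 2) ^ k := by
    rw [zpow_add₀ hQ, zpow_natCast]
  simp only [tripleProductCoeff]
  rw [show 2 * (N + 1) = 2 * N + 1 + 1 by ring, qPochhammer_succ, qPochhammer_succ]
  push_cast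
  rw [← hu, ← hv, a3, a4, a1, a2, a5, a6, b1, b2, c1, c2, c3, c4]
  generalize (q ^ 2) ^ k = y at hy
  rw [show (q ^ 2) ^ (2 * N + 1) = q ^ 2 * ((q ^ 2) ^ N) ^ 2 by ring,
    show (q ^ 2) ^ (2 * N + 1 + 1) = (q ^ 2) ^ 2 * ((q ^ 2) ^ N) ^ 2 by ring,
    show q ^ (4 * N + 2) = q ^ 2 * ((q ^ 2) ^ N) ^ 2 by ring,
    show q ^ (2 * N + 1) = q * (q ^ 2) ^ N by ring]
  generalize (q ^ 2) ^ N = Z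
  generalize q ^ (k ^ 2) = e
  field_simp
  ring

theorem tripleProductCoeff_zero (q : ℝ) (k : ℤ) :
    tripleProductCoeff q 0 k = if k = 0 then 1 else 0 := by
  split_ifs with h
  · subst h
    simp [tripleProductCoeff, invQPochhammer, qPochhammer]
  · rcases lt_or_gt_of_ne h with h | h
    · rw [tripleProductCoeff, invQPochhammer_of_neg (j := ((0 : ℕ) : ℤ) + k) _ (by simpa using h)]
      simp
    · rw [tripleProductCoeff, invQPochhammer_of_neg (j := ((0 : ℕ) : ℤ) - k) _ (by simpa using h)]
      simp

/-- The finite form of the Jacobi triple product. -/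
theorem hasSum_tripleProduct {q : ℝ} (h0 : 0 < q) (h1 : q < 1) {w : ℂ} (hw : w ≠ 0) (N : ℕ) :
    HasSum (fun k : ℤ => (tripleProductCoeff q N k : ℂ) * w ^ k)
      (∏ m ∈ Finset.range N, ((1 + (q : ℂ) ^ (2 * m + 1) * w) * (1 + (q : ℂ) ^ (2 * m + 1) * w⁻¹))) := by
  induction N with
  | zero =>
    have h := hasSum_single (f := fun k : ℤ => (tripleProductCoeff q 0 k : ℂ) * w ^ k) 0
      (fun k hk => by simp [tripleProductCoeff_zero, hk])
    simpa [tripleProductCoeff_zero] using h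
  | succ N ih =>
    have h2 := (((Equiv.subRight (1 : ℤ)).hasSum_iff.2 ih).mul_left ((q : ℂ) ^ (2 * N + 1) * w))
    have h3 := (((Equiv.addRight (1 : ℤ)).hasSum_iff.2 ih).mul_left ((q : ℂ) ^ (2 * N + 1) * w⁻¹))
    have e0 : (fun k : ℤ => (tripleProductCoeff q (N + 1) k : ℂ) * w ^ k) = fun k =>
        (1 + (q : ℂ) ^ (4 * N + 2)) * (tripleProductCoeff q N k * w ^ k) +
        (q : ℂ) ^ (2 * N + 1) * w * (tripleProductCoeff q N (k - 1) * w ^ (k - 1)) +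
        (q : ℂ) ^ (2 * N + 1) * w⁻¹ * (tripleProductCoeff q N (k + 1) * w ^ (k + 1)) := by
      ext k
      have e1 : w * w ^ (k - 1) = w ^ k := by rw [← zpow_one_add₀ hw]; congr 1; ring
      have e2 : w⁻¹ * w ^ (k + 1) = w ^ k := by rw [zpow_add_one₀ hw]; field_simp
      rw [tripleProductCoeff_succ h0 h1]
      push_cast
      linear_combination -((q : ℂ) ^ (2 * N + 1) * tripleProductCoeff q N (k - 1)) * e1 -
        ((q : ℂ) ^ (2 * N + 1) * tripleProductCoeff q N (k + 1)) * e2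
    rw [Finset.prod_range_succ, e0]
    have e3 : ∀ P : ℂ, P * ((1 + (q : ℂ) ^ (2 * N + 1) * w) * (1 + (q : ℂ) ^ (2 * N + 1) * w⁻¹)) =
        (1 + (q : ℂ) ^ (4 * N + 2)) * P + (q : ℂ) ^ (2 * N + 1) * w * P +
          (q : ℂ) ^ (2 * N + 1) * w⁻¹ * P := by
      intro P
      field_simp
      ring
    rw [e3]
    exact ((ih.mul_left _).add h2).add h3

theorem tripleProduct_factor_eq (q t : ℝ) (m : ℕ) :
    (1 + (q : ℂ) ^ (2 * m + 1) * Complex.exp (2 * Real.pi * Complex.I * t)) *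
      (1 + (q : ℂ) ^ (2 * m + 1) * (Complex.exp (2 * Real.pi * Complex.I * t))⁻¹) =
    (((1 - q ^ (2 * m + 1)) ^ 2 + q ^ (2 * m + 1) * (2 * Real.cos (Real.pi * t)) ^ 2 : ℝ) : ℂ) := by
  have hw := Complex.exp_ne_zero (2 * Real.pi * Complex.I * t)
  have h1 : (2 * Complex.cos (Real.pi * t)) ^ 2 = 2 + Complex.exp (2 * Real.pi * Complex.I * t) +
      (Complex.exp (2 * Real.pi * Complex.I * t))⁻¹ := by
    rw [← Complex.exp_neg, Complex.two_cos, add_sq, mul_assoc 2, ← Complex.exp_add, pow_two, pow_two,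
      ← Complex.exp_add, ← Complex.exp_add, neg_mul, add_neg_cancel, Complex.exp_zero]
    rw [show (Real.pi : ℂ) * t * Complex.I + Real.pi * t * Complex.I = 2 * Real.pi * Complex.I * t by ring,
      show -((Real.pi : ℂ) * t * Complex.I) + -(Real.pi * t * Complex.I) =
        -(2 * Real.pi * Complex.I * t) by ring]
    ring
  push_cast
  rw [h1]
  field_simp
  ring

/-- The theta function as a limit of products that are polynomials in `(2 cos (π t))²` with positive
coefficients. -/
theorem exists_tendsto_tripleProduct {α : ℝ} (hα : 0 < α) :
    ∃ L : ℝ, 0 < L ∧ ∀ t : ℝ, Filter.Tendsto (fun N : ℕ => L * ∏ m ∈ Finset.range N,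
      ((1 - Real.exp (-Real.pi * α) ^ (2 * m + 1)) ^ 2 +
        Real.exp (-Real.pi * α) ^ (2 * m + 1) * (2 * Real.cos (Real.pi * t)) ^ 2))
      Filter.atTop (nhds (theta α t)) := by
  set q := Real.exp (-Real.pi * α) with hq
  have h0 : 0 < q := Real.exp_pos _
  have h1 : q < 1 := by
    rw [hq, Real.exp_lt_one_iff]
    nlinarith [Real.pi_pos, mul_pos Real.pi_pos hα]
  have hq0 : 0 ≤ q ^ 2 := sq_nonneg q
  have hq1 : q ^ 2 < 1 := pow_lt_one₀ h0.le h1 two_ne_zero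
  obtain ⟨L, hL, hlim⟩ := exists_tendsto_qPochhammer hq0 hq1
  obtain ⟨c, hc, hcN⟩ := exists_le_qPochhammer hq0 hq1
  refine ⟨L, hL, fun t => ?_⟩
  have hqk : ∀ k : ℤ, q ^ (k ^ 2) = Real.exp (-Real.pi * α * (k : ℝ) ^ 2) := by
    intro k
    rw [← Int.cast_pow, Real.exp_mul (-Real.pi * α), Real.rpow_intCast]
  set w := Complex.exp (2 * Real.pi * Complex.I * t) with hwdef
  have hw : w ≠ 0 := Complex.exp_ne_zero _
  have hwk : ∀ k : ℤ, fourier k (t : UnitAddCircle) = w ^ k := by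
    intro k
    rw [fourier_coe_apply, hwdef, ← Complex.exp_int_mul]
    congr 1
    push_cast
    ring
  have hwn : ∀ k : ℤ, ‖w ^ k‖ = 1 := by
    intro k
    rw [← hwk, fourier_apply, Circle.norm_coe]
  have hθ := hasSum_theta hα (t : UnitAddCircle)
  have hsum : Summable fun k : ℤ => q ^ (k ^ 2) := by
    have := hθ.summable.norm
    refine this.congr fun k => ?_
    rw [norm_mul, hwk, hwn, mul_one, hqk, Complex.norm_real, Real.norm_of_nonneg (Real.exp_pos _).le]
  -- The limit is $q^{k^2}/L$, whence the factor $L$ in front of the product.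
  have hcoef : ∀ k : ℤ, Filter.Tendsto (fun N : ℕ => tripleProductCoeff q N k) Filter.atTop
      (nhds (q ^ (k ^ 2) * L * (L⁻¹ * L⁻¹))) := by
    intro k
    have hinv := tendsto_invQPochhammer hL.ne' hlim
    have hN : Filter.Tendsto (fun N : ℕ => (N : ℤ)) Filter.atTop Filter.atTop :=
      tendsto_natCast_atTop_atTop
    refine Filter.Tendsto.mul (Filter.Tendsto.const_mul _ (hlim.comp ?_)) (Filter.Tendsto.mul (hinv.comp ?_) (hinv.comp ?_))
    · exact Filter.tendsto_atTop_atTop.2 fun b => ⟨b, fun a ha => by omega⟩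
    · simpa only [sub_eq_add_neg] using Filter.tendsto_atTop_add_const_right _ (-k) hN
    · exact Filter.tendsto_atTop_add_const_right _ k hN
  -- A summable bound, uniform in $N$, for dominated convergence.
  have hbound : ∀ (N : ℕ) (k : ℤ),
      ‖(tripleProductCoeff q N k : ℂ) * w ^ k‖ ≤ q ^ (k ^ 2) * (c⁻¹ * c⁻¹) := by
    intro N k
    have b1 := invQPochhammer_nonneg hq0 hq1
    have b2 := invQPochhammer_le hc hcN
    have b3 := qPochhammer_le_one hq0 hq1 (2 * N)
    have b4 := qPochhammer_pos hq0 hq1 (2 * N)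
    rw [norm_mul, hwn, mul_one, Complex.norm_real, Real.norm_of_nonneg, tripleProductCoeff]
    · gcongr
      · exact mul_nonneg (b1 _) (b1 _)
      · exact mul_le_of_le_one_right (by positivity) b3
      · exact b1 _
      · exact b2 _
      · exact b2 _
    · exact mul_nonneg (by positivity) (mul_nonneg (b1 _) (b1 _))
  have hlimsum := tendsto_tsum_of_dominated_convergence (𝓕 := Filter.atTop)
    (f := fun (N : ℕ) (k : ℤ) => (tripleProductCoeff q N k : ℂ) * w ^ k)
    (g := fun k => ((q ^ (k ^ 2) * L * (L⁻¹ * L⁻¹) : ℝ) : ℂ) * w ^ k)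
    (bound := fun k => q ^ (k ^ 2) * (c⁻¹ * c⁻¹)) (hsum.mul_right _)
    (fun k => ((Complex.continuous_ofReal.tendsto _).comp (hcoef k)).mul_const _)
    (Filter.Eventually.of_forall hbound)
  have hlimit : ∑' k : ℤ, ((q ^ (k ^ 2) * L * (L⁻¹ * L⁻¹) : ℝ) : ℂ) * w ^ k = (L⁻¹ * theta α t : ℝ) := by
    push_cast
    rw [← (hθ.mul_left (L : ℂ)⁻¹).tsum_eq]
    refine tsum_congr fun k => ?_
    have hL' : (L : ℂ) ≠ 0 := by exact_mod_cast hL.ne'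
    rw [hwk, ← hqk]
    push_cast
    field_simp
  rw [hlimit] at hlimsum
  simp_rw [(hasSum_tripleProduct h0 h1 hw _).tsum_eq, hwdef, tripleProduct_factor_eq,
    ← Complex.ofReal_prod] at hlimsum
  have h := (((Complex.continuous_re.tendsto _).comp hlimsum).const_mul L)
  simp only [Function.comp_def, Complex.ofReal_re] at h
  rwa [mul_inv_cancel_left₀ hL.ne'] at h

/-! ### Universal optimality for theta functions -/

/-- The energy of a product of linear polynomials in `(2 cos (π t))²` dominates that of one of its
monomials. -/
theorem energyDefect_prod_ge {n : ℕ} (hn : 0 < n) (x : Fin n → ℝ) {A B : ℕ → ℝ} (hA : ∀ m, 0 ≤ A m)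
    (hB : ∀ m, 0 ≤ B m) {K M : ℕ} (hKM : K ≤ M) :
    ((∏ m ∈ Finset.range K, B m) * ∏ m ∈ Finset.range M \ Finset.range K, A m) *
      energyDefect x (fun t => (2 * Real.cos (Real.pi * t)) ^ (2 * K)) ≤
    energyDefect x (fun t => ∏ m ∈ Finset.range M, (A m + B m * (2 * Real.cos (Real.pi * t)) ^ 2)) := by
  have h1 : (fun t => ∏ m ∈ Finset.range M, (A m + B m * (2 * Real.cos (Real.pi * t)) ^ 2)) =
      ∑ s ∈ (Finset.range M).powerset, ((∏ m ∈ s, B m) * ∏ m ∈ Finset.range M \ s, A m) •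
        fun t => (2 * Real.cos (Real.pi * t)) ^ (2 * s.card) := by
    ext t
    simp_rw [add_comm (A _), Finset.prod_add, Finset.sum_apply, Pi.smul_apply, smul_eq_mul]
    refine Finset.sum_congr rfl fun s _ => ?_
    rw [Finset.prod_mul_distrib, Finset.prod_const, pow_mul]
    ring
  rw [h1, map_sum]
  -- In the expansion over subsets every term has nonnegative defect; only the subset `range K` is
  -- kept.
  have h2 := Finset.single_le_sum (s := (Finset.range M).powerset)
    (f := fun s => energyDefect x (((∏ m ∈ s, B m) * ∏ m ∈ Finset.range M \ s, A m) •
        fun t => (2 * Real.cos (Real.pi * t)) ^ (2 * s.card)))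
    (fun s _ => by
      rw [map_smul]
      exact smul_nonneg (mul_nonneg (Finset.prod_nonneg fun m _ => hB m)
        (Finset.prod_nonneg fun m _ => hA m)) (energyDefect_two_cos_pow_nonneg hn x _))
    (Finset.mem_powerset.2 (Finset.range_subset_range.2 hKM))
  simpa using h2

/-- Universal optimality of equispaced points for theta functions, in a quantitative form. -/
theorem exists_energyDefect_theta_ge {α : ℝ} (hα : 0 < α) {n : ℕ} (hn : 0 < n) :
    ∃ κ > 0, ∀ x : Fin n → ℝ,
      κ * energyDefect x (fun t => (2 * Real.cos (Real.pi * t)) ^ (2 * (n - 1))) ≤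
        energyDefect x (fun t => theta α t) := by
  obtain ⟨L, hL, hlim⟩ := exists_tendsto_tripleProduct hα
  set q := Real.exp (-Real.pi * α) with hq
  have h0 : 0 < q := Real.exp_pos _
  have h1 : q < 1 := by
    rw [hq, Real.exp_lt_one_iff]
    nlinarith [Real.pi_pos, mul_pos Real.pi_pos hα]
  obtain ⟨c, hc, hcN⟩ := exists_le_qPochhammer h0.le h1
  have hA0 : ∀ m : ℕ, 0 ≤ 1 - q ^ (2 * m + 1) := fun m =>
    sub_nonneg.2 (pow_le_one₀ h0.le h1.le)
  have hA1 : ∀ m : ℕ, 1 - q ^ (2 * m + 1) ≤ 1 := fun m => by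
    linarith [pow_pos h0 (2 * m + 1)]
  have hprod : ∀ M K : ℕ, K ≤ M →
      c ^ 2 ≤ ∏ m ∈ Finset.range M \ Finset.range K, (1 - q ^ (2 * m + 1)) ^ 2 := by
    intro M K hKM
    rw [Finset.prod_pow]
    refine pow_le_pow_left₀ hc.le ((hcN M).trans ?_) 2
    calc qPochhammer q M ≤ ∏ m ∈ Finset.range M, (1 - q ^ (2 * m + 1)) := by
          refine Finset.prod_le_prod (fun m _ => sub_nonneg.2 (pow_le_one₀ h0.le h1.le)) fun m _ => ?_
          exact sub_le_sub_left (pow_le_pow_of_le_one h0.le h1.le (by omega)) 1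
      _ = (∏ m ∈ Finset.range M \ Finset.range K, (1 - q ^ (2 * m + 1))) *
          ∏ m ∈ Finset.range K, (1 - q ^ (2 * m + 1)) :=
          (Finset.prod_sdiff (Finset.range_subset_range.2 hKM)).symm
      _ ≤ _ := mul_le_of_le_one_right (Finset.prod_nonneg fun m _ => hA0 m)
          (Finset.prod_le_one (fun m _ => hA0 m) fun m _ => hA1 m)
  -- The coefficient of the kept monomial, with the remaining factors $(1-q^{2m+1})^2$ bounded below
  -- by $c^2$ independently of $N$, so that strictness survives the limit.
  refine ⟨L * ((∏ m ∈ Finset.range (n - 1), q ^ (2 * m + 1)) * c ^ 2), ?_, fun x => ?_⟩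
  · have : 0 < ∏ m ∈ Finset.range (n - 1), q ^ (2 * m + 1) :=
      Finset.prod_pos fun m _ => pow_pos h0 _
    positivity
  · have h2 : Filter.Tendsto (fun N : ℕ => energyDefect x (L • fun t => ∏ m ∈ Finset.range N,
        ((1 - q ^ (2 * m + 1)) ^ 2 + q ^ (2 * m + 1) * (2 * Real.cos (Real.pi * t)) ^ 2)))
        Filter.atTop (nhds (energyDefect x (fun t => theta α t))) := by
      simp only [energyDefect_apply, Pi.smul_apply, smul_eq_mul]
      exact (tendsto_finsetSum _ fun i _ => tendsto_finsetSum _ fun j _ => hlim _).sub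
        ((tendsto_finsetSum _ fun j _ => hlim _).const_mul _)
    refine ge_of_tendsto h2 ?_
    filter_upwards [Filter.eventually_ge_atTop (n - 1)] with N hN
    rw [map_smul, smul_eq_mul, mul_assoc]
    refine mul_le_mul_of_nonneg_left (le_trans ?_ (energyDefect_prod_ge hn x
      (fun m => sq_nonneg (1 - q ^ (2 * m + 1))) (fun m => (pow_pos h0 (2 * m + 1)).le) hN)) hL.le
    refine mul_le_mul_of_nonneg_right ?_ (energyDefect_two_cos_pow_nonneg hn x _)
    exact mul_le_mul_of_nonneg_left (hprod N _ hN) (Finset.prod_nonneg fun m _ => (pow_pos h0 _).le)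

theorem energyDefect_theta_nonneg {α : ℝ} (hα : 0 < α) {n : ℕ} (hn : 0 < n) (x : Fin n → ℝ) :
    0 ≤ energyDefect x (fun t => theta α t) := by
  obtain ⟨κ, hκ, h⟩ := exists_energyDefect_theta_ge hα hn
  exact (mul_nonneg hκ.le (energyDefect_two_cos_pow_nonneg hn x _)).trans (h x)

theorem energyDefect_theta_pos {α : ℝ} (hα : 0 < α) {n : ℕ} (hn : 0 < n) (x : Fin n → ℝ)
    {i j : Fin n} (hij : ∀ m : ℤ, (n : ℝ) * (x i - x j) ≠ m) :
    0 < energyDefect x (fun t => theta α t) := by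
  obtain ⟨κ, hκ, h⟩ := exists_energyDefect_theta_ge hα hn
  exact (mul_pos hκ (energyDefect_two_cos_pow_pos hn x hij)).trans_le (h x)

/-! ### The extremal problem on the torus -/

theorem unitAddCircle_coe_eq_coe_iff (a b : ℝ) :
    (a : UnitAddCircle) = b ↔ ∃ m : ℤ, a = m + b := by
  rw [← sub_eq_zero, ← AddCircle.coe_sub, AddCircle.coe_eq_zero_iff]
  simp only [zsmul_eq_mul, mul_one, eq_comm, sub_eq_iff_eq_add]

theorem injOn_unitAddCircle_coe : Set.InjOn (fun t : ℝ => (t : UnitAddCircle)) (Set.Ico 0 1) := by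
  intro a ha b hb h
  exact (AddCircle.coe_eq_coe_iff_of_mem_Ico (p := (1 : ℝ)) (a := 0) (by simpa using ha)
    (by simpa using hb)).1 h

/-- An equispaced set may be indexed by all integers. -/
theorem range_add_fin_div {n : ℕ} (hn : 0 < n) (z : UnitAddCircle) :
    (Set.range fun j : Fin n => z + (((j : ℝ) / n : ℝ) : UnitAddCircle)) =
      Set.range fun m : ℤ => z + (((m : ℝ) / n : ℝ) : UnitAddCircle) := by
  have hn' : (n : ℝ) ≠ 0 := by exact_mod_cast hn.ne'
  ext y
  constructor
  · rintro ⟨j, rfl⟩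
    exact ⟨(j : ℕ), by simp⟩
  · rintro ⟨m, rfl⟩
    have h0 := Int.emod_nonneg m (show (n : ℤ) ≠ 0 by exact_mod_cast hn.ne')
    have h1 := Int.emod_lt_of_pos m (show (0 : ℤ) < n by exact_mod_cast hn)
    refine ⟨⟨(m % n).toNat, by omega⟩, ?_⟩
    have h2 : (((m % n).toNat : ℕ) : ℝ) = m - n * (m / n : ℤ) := by
      have h3 : (((m % n).toNat : ℕ) : ℤ) = m - n * (m / n) := by
        rw [Int.toNat_of_nonneg h0, Int.emod_def]
      exact_mod_cast h3
    simp only [add_right_inj]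
    rw [unitAddCircle_coe_eq_coe_iff]
    refine ⟨-(m / n : ℤ), ?_⟩
    rw [h2]
    push_cast
    field_simp
    ring

theorem continuous_theta {α : ℝ} (hα : 0 < α) : Continuous (theta α) := by
  refine Complex.continuous_re.comp (continuous_tsum (fun k => ?_) (hasSum_theta hα 0).summable.norm
    fun k x => ?_)
  · exact continuous_const.mul (map_continuous (fourier k))
  · simp only [norm_mul, fourier_apply, Circle.norm_coe]
    exact le_rfl

theorem isGreatest_range_thetaSum {α : ℝ} (hα : 0 < α) (S : Finset UnitAddCircle) :
    IsGreatest (Set.range (thetaSum α S)) (maxThetaSum α S) := by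
  have hc : Continuous (thetaSum α S) :=
    continuous_finsetSum _ fun y _ => (continuous_theta hα).comp (continuous_id.sub continuous_const)
  exact (isCompact_range hc).isGreatest_sSup (Set.range_nonempty _)

theorem thetaSum_le_maxThetaSum {α : ℝ} (hα : 0 < α) (S : Finset UnitAddCircle)
    (x : UnitAddCircle) : thetaSum α S x ≤ maxThetaSum α S :=
  (isGreatest_range_thetaSum hα S).2 ⟨x, rfl⟩

theorem sum_fourier_div {n : ℕ} (hn : 0 < n) (k : ℤ) :
    ∑ j : Fin n, fourier k (((j : ℝ) / n : ℝ) : UnitAddCircle) =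
      if (n : ℤ) ∣ k then (n : ℂ) else 0 := by
  rw [← sum_exp_int_div hn]
  refine Finset.sum_congr rfl fun j _ => ?_
  rw [fourier_coe_apply]
  simp

/-- The potential of equispaced points is maximal at the points themselves. -/
theorem sum_theta_sub_div_le {α : ℝ} (hα : 0 < α) {n : ℕ} (hn : 0 < n) (t : UnitAddCircle) :
    ∑ j : Fin n, theta α (t - (((j : ℝ) / n : ℝ) : UnitAddCircle)) ≤
      ∑ j : Fin n, theta α (((j : ℝ) / n : ℝ) : UnitAddCircle) := by
  have h1 := Complex.hasSum_re (hasSum_sum (s := Finset.univ) fun (j : Fin n) _ =>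
    hasSum_theta hα (t - (((j : ℝ) / n : ℝ) : UnitAddCircle)))
  have h2 := Complex.hasSum_re (hasSum_sum (s := Finset.univ) fun (j : Fin n) _ =>
    hasSum_theta hα (((j : ℝ) / n : ℝ) : UnitAddCircle))
  rw [← Complex.ofReal_sum, Complex.ofReal_re] at h1 h2
  -- The Fourier series are compared termwise: frequencies not divisible by $n$ cancel, and the
  -- others have positive coefficients and characters of modulus one.
  refine hasSum_le (fun k => ?_) h1 h2
  have e : ∀ j : Fin n, fourier k (t - (((j : ℝ) / n : ℝ) : UnitAddCircle)) =
      fourier k t * fourier (-k) (((j : ℝ) / n : ℝ) : UnitAddCircle) := by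
    intro j
    rw [sub_eq_add_neg, fourier_apply, fourier_apply, fourier_apply, smul_add, smul_neg,
      AddCircle.toCircle_add, neg_smul, Circle.coe_mul]
  simp_rw [e, ← Finset.mul_sum, sum_fourier_div hn, Int.dvd_neg]
  rw [Complex.re_ofReal_mul, Complex.re_ofReal_mul]
  refine mul_le_mul_of_nonneg_left ?_ (Real.exp_pos _).le
  split_ifs
  · have h3 : (fourier k t : ℂ).re ≤ 1 := by
      refine (Complex.re_le_norm _).trans ?_
      rw [fourier_apply, Circle.norm_coe]
    rw [← Complex.ofReal_natCast, Complex.re_mul_ofReal, Complex.ofReal_re]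
    exact mul_le_of_le_one_left (Nat.cast_nonneg n) h3
  · simp

theorem maxThetaSum_le_of_isEquispacedTorus {α : ℝ} (hα : 0 < α) {n : ℕ} (hn : 0 < n)
    {S : Finset UnitAddCircle} (hS : S.card = n) (h : IsEquispacedTorus n S) :
    maxThetaSum α S ≤ ∑ j : Fin n, theta α (((j : ℝ) / n : ℝ) : UnitAddCircle) := by
  classical
  obtain ⟨z, hz⟩ := h
  set f : Fin n → UnitAddCircle := fun j => z + (((j : ℝ) / n : ℝ) : UnitAddCircle) with hf
  have h1 : S = Finset.univ.image f := by
    apply Finset.coe_injective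
    rw [hz]
    simp
  have h2 : Set.InjOn f (Finset.univ : Finset (Fin n)) := by
    rw [← Finset.card_image_iff, ← h1, hS, Finset.card_univ, Fintype.card_fin]
  refine ciSup_le fun x => ?_
  rw [thetaSum, h1, Finset.sum_image h2]
  simp_rw [hf, ← sub_sub]
  exact sum_theta_sub_div_le hα hn (x - z)

theorem exists_lift_of_card_eq {n : ℕ} {S : Finset UnitAddCircle} (hS : S.card = n) :
    ∃ x : Fin n → ℝ, (∀ i, x i ∈ Set.Ico (0 : ℝ) 1) ∧ Function.Injective x ∧
      (S : Set UnitAddCircle) = Set.range fun i => (x i : UnitAddCircle) := by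
  set e := (Finset.equivFinOfCardEq hS).symm
  have hx : ∀ i, ((AddCircle.equivIco 1 0 (e i : UnitAddCircle) : ℝ) : UnitAddCircle) = e i :=
    fun i => AddCircle.coe_equivIco
  refine ⟨fun i => AddCircle.equivIco 1 0 (e i : UnitAddCircle), fun i => ?_, ?_, ?_⟩
  · simpa using (AddCircle.equivIco 1 0 (e i : UnitAddCircle)).2
  · intro i j hij
    exact e.injective (Subtype.ext ((AddCircle.equivIco 1 0).injective (Subtype.ext hij)))
  · ext y
    simp only [hx, Set.mem_range]
    exact ⟨fun hy => ⟨e.symm ⟨y, hy⟩, by simp⟩, by rintro ⟨i, rfl⟩; exact (e i).2⟩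

theorem eq_image_of_coe_eq_range {n : ℕ} {S : Finset UnitAddCircle} {x : Fin n → ℝ}
    (h : (S : Set UnitAddCircle) = Set.range fun i => (x i : UnitAddCircle)) :
    S = Finset.univ.image fun i => (x i : UnitAddCircle) := by
  apply Finset.coe_injective
  rw [h]
  simp

theorem injective_coe_of_mem_Ico {n : ℕ} {x : Fin n → ℝ} (hx : ∀ i, x i ∈ Set.Ico (0 : ℝ) 1)
    (hi : Function.Injective x) : Function.Injective fun i => (x i : UnitAddCircle) :=
  fun i j h => hi (injOn_unitAddCircle_coe (hx i) (hx j) h)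

theorem thetaSum_eq_sum_fin {n : ℕ} {S : Finset UnitAddCircle} {x : Fin n → ℝ}
    (hx : ∀ i, x i ∈ Set.Ico (0 : ℝ) 1) (hi : Function.Injective x)
    (h : (S : Set UnitAddCircle) = Set.range fun i => (x i : UnitAddCircle)) (α : ℝ)
    (t : UnitAddCircle) : thetaSum α S t = ∑ i, theta α (t - x i) := by
  rw [thetaSum, eq_image_of_coe_eq_range h,
    Finset.sum_image (injective_coe_of_mem_Ico hx hi).injOn]

/-- The energy is the sum of the potential over its own $n$ points, each value being at most the
maximum. -/
theorem energyDefect_theta_le {α : ℝ} (hα : 0 < α) {n : ℕ} {S : Finset UnitAddCircle}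
    {x : Fin n → ℝ} (hx : ∀ i, x i ∈ Set.Ico (0 : ℝ) 1) (hi : Function.Injective x)
    (h : (S : Set UnitAddCircle) = Set.range fun i => (x i : UnitAddCircle)) :
    energyDefect x (fun t => theta α t) ≤
      n * (maxThetaSum α S - ∑ j : Fin n, theta α (((j : ℝ) / n : ℝ) : UnitAddCircle)) := by
  rw [energyDefect_apply, mul_sub]
  refine sub_le_sub_right ?_ _
  calc ∑ i, ∑ j, theta α ((x i - x j : ℝ) : UnitAddCircle)
      = ∑ i, thetaSum α S (x i) := by
        simp_rw [thetaSum_eq_sum_fin hx hi h, AddCircle.coe_sub]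
    _ ≤ ∑ _i : Fin n, maxThetaSum α S :=
        Finset.sum_le_sum fun i _ => thetaSum_le_maxThetaSum hα S _
    _ = n * maxThetaSum α S := by simp

theorem sum_theta_div_le_maxThetaSum {α : ℝ} (hα : 0 < α) {n : ℕ} (hn : 0 < n)
    {S : Finset UnitAddCircle} (hS : S.card = n) :
    ∑ j : Fin n, theta α (((j : ℝ) / n : ℝ) : UnitAddCircle) ≤ maxThetaSum α S := by
  obtain ⟨x, hx, hi, h⟩ := exists_lift_of_card_eq hS
  have h1 := (energyDefect_theta_nonneg hα hn x).trans (energyDefect_theta_le hα hx hi h)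
  exact sub_nonneg.1 (nonneg_of_mul_nonneg_right h1 (by exact_mod_cast hn))

/-- Equality rules out a positive defect, so all differences lie in $\frac1n\mathbb Z$. The $n$
points then fill a coset with at most $n$ elements. -/
theorem isEquispacedTorus_of_maxThetaSum_le {α : ℝ} (hα : 0 < α) {n : ℕ} (hn : 0 < n)
    {S : Finset UnitAddCircle} (hS : S.card = n)
    (hle : maxThetaSum α S ≤ ∑ j : Fin n, theta α (((j : ℝ) / n : ℝ) : UnitAddCircle)) :
    IsEquispacedTorus n S := by
  classical
  obtain ⟨x, hx, hi, h⟩ := exists_lift_of_card_eq hS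
  have hn' : (n : ℝ) ≠ 0 := by exact_mod_cast hn.ne'
  have h1 : ∀ i j : Fin n, ∃ m : ℤ, (n : ℝ) * (x i - x j) = m := by
    by_contra! hcon
    obtain ⟨i, j, hij⟩ := hcon
    have h2 := (energyDefect_theta_pos hα hn x hij).trans_le (energyDefect_theta_le hα hx hi h)
    exact (mul_nonpos_of_nonneg_of_nonpos (Nat.cast_nonneg n) (sub_nonpos.2 hle)).not_gt h2
  set z := ((x ⟨0, hn⟩ : ℝ) : UnitAddCircle)
  set f : Fin n → UnitAddCircle := fun j => z + (((j : ℝ) / n : ℝ) : UnitAddCircle)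
  have h3 : S ⊆ Finset.univ.image f := by
    intro y hy
    obtain ⟨i, rfl⟩ : y ∈ Set.range fun i => (x i : UnitAddCircle) := h ▸ hy
    have h4 : (x i : UnitAddCircle) ∈ Set.range f := by
      rw [range_add_fin_div hn]
      obtain ⟨m, hm⟩ := h1 i ⟨0, hn⟩
      refine ⟨m, ?_⟩
      simp only [z]
      rw [← AddCircle.coe_add, ← hm]
      congr 1
      field_simp
      ring
    simpa using h4
  have h5 : S = Finset.univ.image f :=
    Finset.eq_of_subset_of_card_le h3 (Finset.card_image_le.trans (by simp [hS]))
  exact ⟨z, by rw [h5]; simp [f]⟩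

theorem exists_isEquispacedTorus {n : ℕ} (hn : 0 < n) :
    ∃ S : Finset UnitAddCircle, S.card = n ∧ IsEquispacedTorus n S := by
  classical
  have hn' : (0 : ℝ) < n := by exact_mod_cast hn
  refine ⟨Finset.univ.image fun j : Fin n => (((j : ℝ) / n : ℝ) : UnitAddCircle), ?_, 0, by simp⟩
  rw [Finset.card_image_of_injective, Finset.card_univ, Fintype.card_fin]
  refine injective_coe_of_mem_Ico (fun j => ⟨by positivity, ?_⟩) fun i j hij => ?_
  · rw [div_lt_one hn']
    exact_mod_cast j.2
  · exact Fin.ext (by exact_mod_cast (div_left_inj' hn'.ne').1 hij)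

/-- Among all sets of `n` points on the torus, precisely the equispaced ones minimise the maximum of
the potential. -/
theorem isMinOn_maxThetaSum_iff {α : ℝ} (hα : 0 < α) {n : ℕ} (hn : 0 < n)
    {S : Finset UnitAddCircle} (hS : S.card = n) :
    IsMinOn (maxThetaSum α) {T : Finset UnitAddCircle | T.card = n} S ↔ IsEquispacedTorus n S := by
  constructor
  · intro h
    obtain ⟨T, hT, hTe⟩ := exists_isEquispacedTorus hn
    exact isEquispacedTorus_of_maxThetaSum_le hα hn hS
      ((isMinOn_iff.1 h T hT).trans (maxThetaSum_le_of_isEquispacedTorus hα hn hT hTe))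
  · intro h
    exact isMinOn_iff.2 fun T hT => (maxThetaSum_le_of_isEquispacedTorus hα hn hS h).trans
      (sum_theta_div_le_maxThetaSum hα hn hT)

/-! ### Periodic sets on the line as preimages of sets on the torus -/

/-- The periodic subset of the real line, with period `L`, that corresponds to a set of points on the
torus. -/
def periodicLift (L : ℝ) (S : Set UnitAddCircle) : Set ℝ :=
  (fun y : ℝ => ((y / L : ℝ) : UnitAddCircle)) ⁻¹' S

theorem surjective_coe_div {L : ℝ} (hL : L ≠ 0) :
    Function.Surjective fun y : ℝ => ((y / L : ℝ) : UnitAddCircle) := by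
  intro t
  obtain ⟨u, rfl⟩ := QuotientAddGroup.mk_surjective t
  exact ⟨L * u, by simp only [mul_div_cancel_left₀ _ hL]⟩

theorem periodicLift_range {L : ℝ} (hL : L ≠ 0) {n : ℕ} (x : Fin n → ℝ) :
    periodicLift L (Set.range fun i => (x i : UnitAddCircle)) =
      Set.range fun p : Fin n × ℤ => L * (p.2 + x p.1) := by
  ext y
  simp only [periodicLift, Set.mem_preimage, Set.mem_range, Prod.exists]
  refine exists_congr fun i => ?_
  rw [eq_comm, unitAddCircle_coe_eq_coe_iff]
  refine exists_congr fun m => ?_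
  rw [div_eq_iff hL, eq_comm, mul_comm]

theorem smul_iUnion_range_add (L : ℝ) {n : ℕ} (x : Fin n → ℝ) :
    L • (⋃ k : Fin n, Set.range fun m : ℤ => (m : ℝ) + x k) =
      Set.range fun p : Fin n × ℤ => L * (p.2 + x p.1) := by
  ext y
  simp [Set.mem_smul_set]

theorem mem_periodicConfigurations_iff {n : ℕ} (hn : 0 < n) {δ : ℝ} (hδ : 0 < δ) (Γ : Set ℝ) :
    Γ ∈ periodicConfigurations n δ ↔
      ∃ S : Finset UnitAddCircle, S.card = n ∧ Γ = periodicLift (n / δ) S := by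
  classical
  have hL : (n : ℝ) / δ ≠ 0 := (div_pos (by exact_mod_cast hn) hδ).ne'
  constructor
  · rintro ⟨-, x, hx, hi, rfl⟩
    refine ⟨Finset.univ.image fun i => (x i : UnitAddCircle), ?_, ?_⟩
    · rw [Finset.card_image_of_injective _ (injective_coe_of_mem_Ico hx hi), Finset.card_univ,
        Fintype.card_fin]
    · rw [smul_iUnion_range_add, ← periodicLift_range hL]
      simp
  · rintro ⟨S, hS, rfl⟩
    obtain ⟨x, hx, hi, h⟩ := exists_lift_of_card_eq hS
    exact ⟨hn, x, hx, hi, by rw [smul_iUnion_range_add, ← periodicLift_range hL, h]⟩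

theorem periodicLift_range_add_div {n : ℕ} (hn : 0 < n) {δ : ℝ} (hδ : 0 < δ) (z : ℝ) :
    periodicLift (n / δ)
      (Set.range fun m : ℤ => ((z / (n / δ) : ℝ) : UnitAddCircle) + (((m : ℝ) / n : ℝ) : UnitAddCircle)) =
      Set.range fun m : ℤ => z + (m : ℝ) / δ := by
  have hn' : (n : ℝ) ≠ 0 := by exact_mod_cast hn.ne'
  ext y
  simp only [periodicLift, Set.mem_preimage, Set.mem_range, ← AddCircle.coe_add]
  constructor
  · rintro ⟨m, hm⟩
    obtain ⟨k, hk⟩ := (unitAddCircle_coe_eq_coe_iff _ _).1 hm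
    refine ⟨m - k * n, ?_⟩
    push_cast
    field_simp at hk ⊢
    linarith
  · rintro ⟨m, rfl⟩
    refine ⟨m, ?_⟩
    congr 1
    field_simp

theorem isEquispacedLine_periodicLift_iff {n : ℕ} (hn : 0 < n) {δ : ℝ} (hδ : 0 < δ)
    (S : Finset UnitAddCircle) :
    IsEquispacedLine δ (periodicLift (n / δ) S) ↔ IsEquispacedTorus n S := by
  have hL : (n : ℝ) / δ ≠ 0 := (div_pos (by exact_mod_cast hn) hδ).ne'
  simp only [IsEquispacedLine, IsEquispacedTorus, range_add_fin_div hn]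
  constructor
  · rintro ⟨z, hz⟩
    rw [← periodicLift_range_add_div hn hδ] at hz
    exact ⟨_, (surjective_coe_div hL).preimage_injective hz⟩
  · rintro ⟨w, hw⟩
    obtain ⟨z, rfl⟩ := surjective_coe_div hL w
    exact ⟨z, by rw [hw, periodicLift_range_add_div hn hδ]⟩

/-- The number of points per period is arbitrary here, which makes configurations with different
numbers comparable. -/
theorem IsEquispacedLine.mem_periodicConfigurations {n : ℕ} (hn : 0 < n) {δ : ℝ} (hδ : 0 < δ)
    {Γ : Set ℝ} (h : IsEquispacedLine δ Γ) : Γ ∈ periodicConfigurations n δ := by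
  classical
  have hn' : (0 : ℝ) < n := by exact_mod_cast hn
  obtain ⟨z, rfl⟩ := h
  rw [← periodicLift_range_add_div hn hδ, ← range_add_fin_div hn, mem_periodicConfigurations_iff hn hδ]
  refine ⟨Finset.univ.image fun j : Fin n =>
    ((z / (n / δ) : ℝ) : UnitAddCircle) + (((j : ℝ) / n : ℝ) : UnitAddCircle), ?_, by simp⟩
  rw [Finset.card_image_of_injective, Finset.card_univ, Fintype.card_fin]
  refine (add_right_injective _).comp
    (injective_coe_of_mem_Ico (x := fun j : Fin n => (j : ℝ) / n) (fun j => ⟨by positivity, ?_⟩)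
      fun i j hij => ?_)
  · rw [div_lt_one hn']
    exact_mod_cast j.2
  · exact Fin.ext (by exact_mod_cast (div_left_inj' hn'.ne').1 hij)

/-! ### Poisson summation and transfer to the line -/

theorem summable_exp_neg_mul_int_sub_sq {b : ℝ} (hb : 0 < b) (u : ℝ) :
    Summable fun m : ℤ => Real.exp (-Real.pi * b * ((m : ℝ) - u) ^ 2) := by
  -- The imaginary first argument produces the cross term $e^{2\pi bmu}$ of the expanded square.
  have h := ((summable_jacobiTheta₂_term_iff (-Complex.I * b * u) (Complex.I * b)).2
    (by simpa using hb)).norm.mul_left (Real.exp (-Real.pi * b * u ^ 2))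
  refine h.congr fun m => ?_
  rw [jacobiTheta₂_term, Complex.norm_exp, ← Real.exp_add]
  congr 1
  have : (2 * Real.pi * Complex.I * m * (-Complex.I * b * u) +
      Real.pi * Complex.I * (m : ℂ) ^ 2 * (Complex.I * b) : ℂ) =
      ((2 * Real.pi * m * b * u - Real.pi * m ^ 2 * b : ℝ) : ℂ) := by
    push_cast
    linear_combination (-(2 * Real.pi * m * b * u) + Real.pi * m ^ 2 * b : ℂ) * Complex.I_sq
  rw [this, Complex.ofReal_re]
  ring

/-- Poisson summation: the periodisation of a Gaussian is a theta function. -/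
theorem hasSum_exp_neg_mul_int_sub_sq {b : ℝ} (hb : 0 < b) (u : ℝ) :
    HasSum (fun m : ℤ => Real.exp (-Real.pi * b⁻¹ * ((m : ℝ) - u) ^ 2))
      (√b * theta b (u : UnitAddCircle)) := by
  have hs := summable_exp_neg_mul_int_sub_sq (inv_pos.2 hb) u
  have hb' : (b : ℂ) ≠ 0 := by exact_mod_cast hb.ne'
  have h1 := Complex.tsum_exp_neg_quadratic (a := b) (by simpa using hb) (Complex.I * u)
  have h2 : ∑' m : ℤ, Complex.exp (-Real.pi * b * (m : ℂ) ^ 2 + 2 * Real.pi * (Complex.I * u) * m) =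
      theta b (u : UnitAddCircle) := by
    rw [← (hasSum_theta hb (u : UnitAddCircle)).tsum_eq]
    refine tsum_congr fun m => ?_
    rw [fourier_coe_apply, Complex.ofReal_exp, ← Complex.exp_add]
    congr 1
    push_cast
    ring
  have h3 : ∑' m : ℤ, Complex.exp (-Real.pi / b * ((m : ℂ) + Complex.I * (Complex.I * u)) ^ 2) =
      ((∑' m : ℤ, Real.exp (-Real.pi * b⁻¹ * ((m : ℝ) - u) ^ 2) : ℝ) : ℂ) := by
    rw [Complex.ofReal_tsum]
    refine tsum_congr fun m => ?_
    rw [← mul_assoc, Complex.I_mul_I]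
    push_cast
    congr 1
    ring
  have h4 : (b : ℂ) ^ (1 / 2 : ℂ) = (√b : ℝ) := by
    rw [Real.sqrt_eq_rpow, Complex.ofReal_cpow hb.le]
    norm_num
  rw [h2, h3, h4] at h1
  have h5 : theta b (u : UnitAddCircle) =
      1 / √b * ∑' m : ℤ, Real.exp (-Real.pi * b⁻¹ * ((m : ℝ) - u) ^ 2) := by
    exact_mod_cast h1
  have h6 : √b ≠ 0 := (Real.sqrt_pos.2 hb).ne'
  rw [h5, ← mul_assoc, mul_one_div_cancel h6, one_mul]
  exact hs.hasSum

/-- The Gaussian sum over a periodic set in terms of theta functions. -/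
theorem hasSum_gaussianSum_periodicLift {α : ℝ} (hα : 0 < α) {L : ℝ} (hL : 0 < L)
    (S : Finset UnitAddCircle) (y : ℝ) :
    HasSum (fun γ : periodicLift L S => Real.exp (-Real.pi * α * (y - γ) ^ 2))
      (√((α * L ^ 2)⁻¹) * thetaSum (α * L ^ 2)⁻¹ S ((y / L : ℝ) : UnitAddCircle)) := by
  obtain ⟨x, hx, hi, h⟩ := exists_lift_of_card_eq (rfl : S.card = S.card)
  -- Rescaling by $L$ gives the Gaussian exponent $\alpha L^2$, which Poisson summation inverts.
  set β := (α * L ^ 2)⁻¹ with hβ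
  have hβ0 : 0 < β := by positivity
  rw [thetaSum_eq_sum_fin hx hi h, h, periodicLift_range hL.ne', Finset.mul_sum]
  have hinj : Function.Injective fun p : Fin S.card × ℤ => L * (p.2 + x p.1) := by
    rintro ⟨i, m⟩ ⟨j, k⟩ hp
    have hp' : (m : ℝ) + x i = k + x j := mul_left_cancel₀ hL.ne' hp
    have hij : i = j := injective_coe_of_mem_Ico hx hi
      ((unitAddCircle_coe_eq_coe_iff _ _).2 ⟨k - m, by push_cast; linarith⟩)
    subst hij
    have hmk : m = k := by exact_mod_cast add_right_cancel hp'
    rw [hmk]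
  rw [← (Equiv.ofInjective _ hinj).hasSum_iff]
  have hfib : ∀ i : Fin S.card, HasSum (fun m : ℤ =>
      Real.exp (-Real.pi * α * (y - L * (m + x i)) ^ 2))
      (√β * theta β (((y / L : ℝ) : UnitAddCircle) - x i)) := by
    intro i
    rw [← AddCircle.coe_sub]
    refine (hasSum_exp_neg_mul_int_sub_sq hβ0 (y / L - x i)).congr_fun fun m => ?_
    rw [hβ, inv_inv]
    congr 1
    field_simp
    ring
  have hsum : Summable fun p : Fin S.card × ℤ =>
      Real.exp (-Real.pi * α * (y - L * (p.2 + x p.1)) ^ 2) := by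
    rw [summable_prod_of_nonneg fun p => (Real.exp_pos _).le]
    exact ⟨fun i => (hfib i).summable, Summable.of_finite⟩
  have h1 := hsum.hasSum.prod_fiberwise hfib
  rw [← h1.unique (hasSum_fintype _)]
  exact hsum.hasSum

theorem gaussianSum_periodicLift {α : ℝ} (hα : 0 < α) {L : ℝ} (hL : 0 < L)
    (S : Finset UnitAddCircle) (y : ℝ) :
    gaussianSum α (periodicLift L S) y =
      √((α * L ^ 2)⁻¹) * thetaSum (α * L ^ 2)⁻¹ S ((y / L : ℝ) : UnitAddCircle) :=
  (hasSum_gaussianSum_periodicLift hα hL S y).tsum_eq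

theorem isGreatest_range_gaussianSum_periodicLift {α : ℝ} (hα : 0 < α) {L : ℝ} (hL : 0 < L)
    (S : Finset UnitAddCircle) :
    IsGreatest (Set.range (gaussianSum α (periodicLift L S)))
      (√((α * L ^ 2)⁻¹) * maxThetaSum (α * L ^ 2)⁻¹ S) := by
  have hβ : 0 < (α * L ^ 2)⁻¹ := by positivity
  obtain ⟨⟨t, ht⟩, -⟩ := isGreatest_range_thetaSum hβ S
  obtain ⟨y, rfl⟩ := surjective_coe_div hL.ne' t
  constructor
  · exact ⟨y, by rw [gaussianSum_periodicLift hα hL, ← ht]⟩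
  · rintro _ ⟨y, rfl⟩
    rw [gaussianSum_periodicLift hα hL]
    exact mul_le_mul_of_nonneg_left (thetaSum_le_maxThetaSum hβ S _) (Real.sqrt_nonneg _)

theorem maxGaussianSum_periodicLift {α : ℝ} (hα : 0 < α) {L : ℝ} (hL : 0 < L)
    (S : Finset UnitAddCircle) :
    maxGaussianSum α (periodicLift L S) = √((α * L ^ 2)⁻¹) * maxThetaSum (α * L ^ 2)⁻¹ S :=
  (isGreatest_range_gaussianSum_periodicLift hα hL S).csSup_eq

/-- For fixed $n$ and $\delta$, the maxima on the line and on the torus differ by a positive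
constant factor, so the minimisers correspond. -/
theorem isMinOn_maxGaussianSum_iff {α : ℝ} (hα : 0 < α) {n : ℕ} (hn : 0 < n) {δ : ℝ} (hδ : 0 < δ)
    {Γ : Set ℝ} (hΓ : Γ ∈ periodicConfigurations n δ) :
    IsMinOn (maxGaussianSum α) (periodicConfigurations n δ) Γ ↔ IsEquispacedLine δ Γ := by
  have hL : 0 < (n : ℝ) / δ := div_pos (by exact_mod_cast hn) hδ
  have hβ : 0 < (α * ((n : ℝ) / δ) ^ 2)⁻¹ := by positivity
  obtain ⟨S, hS, rfl⟩ := (mem_periodicConfigurations_iff hn hδ Γ).1 hΓ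
  rw [isEquispacedLine_periodicLift_iff hn hδ, ← isMinOn_maxThetaSum_iff hβ hn hS, isMinOn_iff,
    isMinOn_iff]
  have key : ∀ T : Finset UnitAddCircle,
      (maxGaussianSum α (periodicLift (n / δ) S) ≤ maxGaussianSum α (periodicLift (n / δ) T) ↔
        maxThetaSum (α * ((n : ℝ) / δ) ^ 2)⁻¹ S ≤ maxThetaSum (α * ((n : ℝ) / δ) ^ 2)⁻¹ T) := by
    intro T
    rw [maxGaussianSum_periodicLift hα hL, maxGaussianSum_periodicLift hα hL]
    exact mul_le_mul_iff_right₀ (Real.sqrt_pos.2 hβ)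
  constructor
  · intro h T hT
    exact (key T).1 (h _ ((mem_periodicConfigurations_iff hn hδ _).2 ⟨T, hT, rfl⟩))
  · intro h Γ' hΓ'
    obtain ⟨T, hT, rfl⟩ := (mem_periodicConfigurations_iff hn hδ Γ').1 hΓ'
    exact (key T).2 (h T hT)

/-- An equispaced set belongs to the class of every $m\ge1$ and is minimal in each, hence in the
union. -/
theorem isMinOn_maxGaussianSum_iUnion_iff {α : ℝ} (hα : 0 < α) {n : ℕ} (hn : 0 < n) {δ : ℝ}
    (hδ : 0 < δ) {Γ : Set ℝ} (hΓ : Γ ∈ periodicConfigurations n δ) :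
    IsMinOn (maxGaussianSum α) (⋃ m : ℕ, periodicConfigurations m δ) Γ ↔ IsEquispacedLine δ Γ := by
  constructor
  · exact fun h => (isMinOn_maxGaussianSum_iff hα hn hδ hΓ).1
      (h.on_subset (Set.subset_iUnion (fun m => periodicConfigurations m δ) n))
  · refine fun h => isMinOn_iff.2 fun Γ' hΓ' => ?_
    obtain ⟨m, hm⟩ := Set.mem_iUnion.1 hΓ'
    have hm0 : 0 < m := hm.1
    exact isMinOn_iff.1 ((isMinOn_maxGaussianSum_iff hα hm0 hδ
      (h.mem_periodicConfigurations hm0 hδ)).2 h) Γ' hm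

theorem proposition1 (α : ℝ) (hα : 0 < α) (n : ℕ) (hn : 0 < n) :
    -- configurations on the real line
    (∀ δ : ℝ, 0 < δ → ∀ Γ ∈ periodicConfigurations n δ,
      -- `p_α` is well defined and attains its maximum
      (∀ x : ℝ, Summable fun γ : Γ => Real.exp (-Real.pi * α * (x - γ) ^ 2)) ∧
      IsGreatest (Set.range (gaussianSum α Γ)) (maxGaussianSum α Γ) ∧
      -- optimality among the configurations of density `δ` with `n` points per period
      (IsMinOn (maxGaussianSum α) (periodicConfigurations n δ) Γ ↔ IsEquispacedLine δ Γ) ∧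
      -- optimality among all periodic configurations of density `δ`
      (IsMinOn (maxGaussianSum α) (⋃ m : ℕ, periodicConfigurations m δ) Γ ↔
        IsEquispacedLine δ Γ)) ∧
    -- sets of `n` points on the torus
    (∀ S : Finset UnitAddCircle, S.card = n →
      IsGreatest (Set.range (thetaSum α S)) (maxThetaSum α S) ∧
      (IsMinOn (maxThetaSum α) {T : Finset UnitAddCircle | T.card = n} S ↔
        IsEquispacedTorus n S)) := by
  refine ⟨fun δ hδ Γ hΓ => ⟨?_, ?_, isMinOn_maxGaussianSum_iff hα hn hδ hΓ,
    isMinOn_maxGaussianSum_iUnion_iff hα hn hδ hΓ⟩,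
    fun S hS => ⟨isGreatest_range_thetaSum hα S, isMinOn_maxThetaSum_iff hα hn hS⟩⟩
  all_goals
    have hL : 0 < (n : ℝ) / δ := div_pos (by exact_mod_cast hn) hδ
    obtain ⟨S, -, rfl⟩ := (mem_periodicConfigurations_iff hn hδ Γ).1 hΓ
  · exact fun y => (hasSum_gaussianSum_periodicLift hα hL S y).summable
  · rw [maxGaussianSum_periodicLift hα hL]
    exact isGreatest_range_gaussianSum_periodicLift hα hL S
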